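/- All graphs are finite and simple. A \emph{kite} in a graph is a subgraph formed by two distinct 3-cycles that share an edge. Write $\Delta(G)$ for the maximum degree of $G$ and $\chi'(G)$ for its edge chromatic number. The list edge chromatic number $\chi'_l(G)$ is the least integer $k$ such that, whenever every edge $e$ of $G$ is assigned a list $L(e)$ of at least $k$ colors, the edges of $G$ can be colored so that each edge $e$ receives a color from $L(e)$ and any two distinct edges with a common endpoint receive distinct colors. \textbf{Theorem.} If $G$ is a planar graph that contains no kites and $\Delta(G)\ge 9$, then $\chi'_l(G)=\Delta(G)$. Moreover $\chi'_l(G)=\chi'(G)$, that is, the List Coloring Conjecture holds for $G$. -/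

import Mathlib

/-- `IsPolygonalArc A p q`: the set `A` is a simple polygonal arc in the plane with ends `p` and
`q`, that is, a finite chain of non-degenerate straight line segments leading from `p` to `q` in
which each segment meets the rest of the chain after it only in the point where they are joined. -/
inductive IsPolygonalArc : Set (ℝ × ℝ) → ℝ × ℝ → ℝ × ℝ → Prop
  | single (p q : ℝ × ℝ) (hpq : p ≠ q) : IsPolygonalArc (segment ℝ p q) p q
  | cons (p q r : ℝ × ℝ) (A : Set (ℝ × ℝ)) (hpq : p ≠ q) (hA : IsPolygonalArc A q r)
      (hinter : segment ℝ p q ∩ A = {q}) : IsPolygonalArc (segment ℝ p q ∪ A) p r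

namespace SimpleGraph

universe u

variable {V : Type u}

/-- A crossing-free drawing of `G` in the plane: the vertices are distinct points, each edge is a
simple polygonal arc joining its two ends, an arc contains no vertex other than its two ends, and
two different arcs meet only in a common end. -/
structure PlaneDrawing (G : SimpleGraph V) where
  point : V → ℝ × ℝ
  point_injective : Function.Injective point
  arc : G.edgeSet → Set (ℝ × ℝ)
  isPolygonalArc : ∀ (e : G.edgeSet) (v w : V), (e : Sym2 V) = s(v, w) →
    IsPolygonalArc (arc e) (point v) (point w)
  mem_of_point_mem : ∀ (e : G.edgeSet) (v : V), point v ∈ arc e → v ∈ (e : Sym2 V)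
  eq_point_of_mem_of_mem : ∀ (e f : G.edgeSet), e ≠ f → ∀ x, x ∈ arc e → x ∈ arc f →
    ∃ v : V, v ∈ (e : Sym2 V) ∧ v ∈ (f : Sym2 V) ∧ x = point v

/-- A graph is planar if it can be drawn in the plane without crossings. -/
def IsPlanar (G : SimpleGraph V) : Prop := Nonempty G.PlaneDrawing

/-- `G` contains a kite: two different 3-cycles `v w x` and `v w y` sharing the edge `v w`. -/
def HasKite (G : SimpleGraph V) : Prop :=
  ∃ v w x y : V, x ≠ y ∧ G.Adj v w ∧ G.Adj v x ∧ G.Adj w x ∧ G.Adj v y ∧ G.Adj w y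

/-- `G` is `k`-edge-choosable: whenever each edge `e` has a list `L e` of at least `k` colors,
the edges can be properly colored (edges with a common end get different colors, i.e. the line
graph is properly colored) so that each edge gets a color from its list. -/
def EdgeChoosable (G : SimpleGraph V) (k : ℕ) : Prop :=
  ∀ (C : Type) (L : G.edgeSet → Finset C), (∀ e, k ≤ (L e).card) →
    ∃ c : G.lineGraph.Coloring C, ∀ e, c e ∈ L e

/-- The list edge chromatic number: the least `k` such that `G` is `k`-edge-choosable
(`⊤` if there is none). -/
noncomputable def listEdgeChromaticNumber (G : SimpleGraph V) : ℕ∞ :=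
  ⨅ (k : ℕ) (_ : G.EdgeChoosable k), (k : ℕ∞)

/-- The edge chromatic number: the chromatic number of the line graph. -/
noncomputable def edgeChromaticNumber (G : SimpleGraph V) : ℕ∞ :=
  G.lineGraph.chromaticNumber

end SimpleGraph

/-! The lower bound is immediate, since the edges at a vertex of maximum degree form a clique of the
line graph. For the upper bound, fix `k ≥ 9` bounding all degrees and take a planar kite-free graph
that is not `k`-edge-choosable although its proper subgraphs are.

Minimality gives two reductions. An edge whose end degrees sum to at most `k + 1` could be colored
last (`add_two_le_degree_add_degree`), so no degree is 1 and the vertices of degree at most 3 are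
independent. If `U` is an independent set of vertices of degree between 1 and `i`, some neighbor of
`U` has fewer than `i` neighbors in `U`: otherwise color the edges missing `U` first, then the
bipartite graph at `U` from the remaining lists, by a form of Galvin's theorem in which the list
sizes are local degrees (`exists_list_edge_coloring`). Peeling off such neighbors gives every vertex
of degree at most `i ≤ 3` an adjacent master that serves at most `i - 1` of them (`exists_masters`).

Now give a vertex of degree `d` the charge `2d - 8` and a face of length `l` the charge `2l - 8`; by
Euler's formula the total is negative. Only triangles are negative faces, with charge `-2`. The
degree condition leaves each triangle at least two corners of degree at least 5, which therefore pay
at most 1 each. Without kites at most half of the angles at a vertex are triangular, so it pays at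
most `d / 2`. Finally every vertex of degree at most 2 receives 2 from its master for `i = 2`, and
every vertex of degree at most 3 receives 2 from its master for `i = 3`. No vertex ends up negative,
a contradiction.

Euler's inequality is obtained without the Jordan curve theorem. Faces are orbits of darts under the
clockwise rotation. For an even edge weight, a signed count modulo 2 of the arcs above a point is
locally constant off the drawing and jumps by the weight across each edge. Reading it on the left of
every dart shows that even weights are coboundaries of functions on the faces (`exists_faceMap`),
and comparing dimensions bounds the number of faces from below. -/

open Filter Topology

/-! ### Parity functions of segments and polygonal arcs -/

/-- The jump at `x`, relative to `x₀`, produced by the downward vertical ray from `p`. -/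
noncomputable def rayJump (p x₀ x : ℝ × ℝ) : ZMod 2 :=
  if x₀.1 = p.1 ∧ x₀.2 < p.2 ∧ x.1 < p.1 then 1 else 0

/-- The indicator, modulo 2, of the points that lie vertically below the segment from `p` to `q`. -/
noncomputable def belowSegment (p q x : ℝ × ℝ) : ZMod 2 :=
  if ((p.1 ≤ x.1 ∧ x.1 < q.1) ∨ (q.1 ≤ x.1 ∧ x.1 < p.1)) ∧
    (q.1 - p.1) * ((q.1 - p.1) * (x.2 - p.2) - (q.2 - p.2) * (x.1 - p.1)) < 0 then 1 else 0

/-- The vector `u` rotated counterclockwise by a right angle. -/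
def leftNormal (u : ℝ × ℝ) : ℝ × ℝ := (-u.2, u.1)

theorem belowSegment_comm (p q x : ℝ × ℝ) : belowSegment p q x = belowSegment q p x := by
  unfold belowSegment
  have : (q.1 - p.1) * ((q.1 - p.1) * (x.2 - p.2) - (q.2 - p.2) * (x.1 - p.1)) =
    (p.1 - q.1) * ((p.1 - q.1) * (x.2 - q.2) - (p.2 - q.2) * (x.1 - q.1)) := by ring
  simp only [this, or_comm]

theorem ZMod.add_self_two (a : ZMod 2) : a + a = 0 := CharTwo.add_self_eq_zero a

theorem eventually_fst_lt {x₀ : ℝ × ℝ} {a : ℝ} (h : x₀.1 < a) : ∀ᶠ x : ℝ × ℝ in 𝓝 x₀, x.1 < a :=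
  continuous_fst.continuousAt.eventually_lt_const h

theorem eventually_lt_fst {x₀ : ℝ × ℝ} {a : ℝ} (h : a < x₀.1) : ∀ᶠ x : ℝ × ℝ in 𝓝 x₀, a < x.1 :=
  continuous_fst.continuousAt.eventually_const_lt h

theorem mem_segment_of_cross_eq_zero {p q x : ℝ × ℝ} (h1 : p.1 < x.1) (h2 : x.1 < q.1)
    (h : (q.1 - p.1) * (x.2 - p.2) - (q.2 - p.2) * (x.1 - p.1) = 0) : x ∈ segment ℝ p q := by
  have hd : (0 : ℝ) < q.1 - p.1 := by linarith
  refine ⟨(q.1 - x.1) / (q.1 - p.1), (x.1 - p.1) / (q.1 - p.1),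
    div_nonneg (by linarith) hd.le, div_nonneg (by linarith) hd.le, by field_simp; ring, ?_⟩
  ext
  · simp; field_simp; ring
  · simp; field_simp; linarith

/-- Off the segment the indicator is discontinuous only across the vertical rays below `p` and `q`.
The strip is closed on the left and open on the right, so at both rays the value flips exactly when
one moves to the left, as `rayJump` does. -/
theorem eventually_belowSegment_of_lt {p q x₀ : ℝ × ℝ} (hpq : p.1 < q.1)
    (hx₀ : x₀ ∉ segment ℝ p q) :
    ∀ᶠ x in 𝓝 x₀, belowSegment p q x = belowSegment p q x₀ + rayJump p x₀ x + rayJump q x₀ x := by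
  have hcont : Continuous fun x : ℝ × ℝ =>
      (q.1 - p.1) * ((q.1 - p.1) * (x.2 - p.2) - (q.2 - p.2) * (x.1 - p.1)) := by fun_prop
  have hd : (0 : ℝ) < q.1 - p.1 := by linarith
  have hneg (h : (q.1 - p.1) * ((q.1 - p.1) * (x₀.2 - p.2) - (q.2 - p.2) * (x₀.1 - p.1)) < 0) :=
    hcont.continuousAt.eventually_lt_const h
  have hpos (h : 0 < (q.1 - p.1) * ((q.1 - p.1) * (x₀.2 - p.2) - (q.2 - p.2) * (x₀.1 - p.1))) :=
    hcont.continuousAt.eventually_const_lt h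
  unfold belowSegment rayJump
  rcases lt_trichotomy x₀.1 p.1 with h1 | h1 | h1
  · filter_upwards [eventually_fst_lt h1] with x hx
    simp [h1.not_ge, hx.not_ge, h1.ne, (hx.trans hpq).not_ge, (h1.trans hpq).not_ge,
      (h1.trans hpq).ne]
  · have hne : x₀.2 ≠ p.2 := fun h => hx₀ (by
      rw [show x₀ = p from Prod.ext h1 h]; exact left_mem_segment ℝ p q)
    rcases lt_or_gt_of_ne hne with h2 | h2
    · have h3 : (q.1 - p.1) * ((q.1 - p.1) * (x₀.2 - p.2)) < 0 := by
        nlinarith [mul_pos hd hd]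
      have h3' : (q.1 - p.1) * ((q.1 - p.1) * (x₀.2 - p.2) - (q.2 - p.2) * (x₀.1 - p.1)) < 0 := by
        simpa only [h1, sub_self, mul_zero, sub_zero] using h3
      filter_upwards [hneg h3', eventually_fst_lt (h1.trans_lt hpq)] with x hx hx2
      by_cases hx3 : x.1 < p.1
      · simp [h3, hpq, h1, hpq.not_ge, hpq.ne, h2, hx3, hx3.not_ge, hx2.not_ge,
          ZMod.add_self_two]
      · simp [h3, hpq, h1, hpq.not_ge, hpq.ne, h2, hx3, not_lt.1 hx3, hx2.not_ge, hx, hx2]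
    · have h3 : 0 < (q.1 - p.1) * ((q.1 - p.1) * (x₀.2 - p.2)) :=
        mul_pos hd (mul_pos hd (by linarith))
      have h3' : 0 < (q.1 - p.1) * ((q.1 - p.1) * (x₀.2 - p.2) - (q.2 - p.2) * (x₀.1 - p.1)) := by
        simpa only [h1, sub_self, mul_zero, sub_zero] using h3
      filter_upwards [hpos h3'] with x hx
      simp [h3.not_gt, hx.not_gt, h1, hpq.ne, h2.not_gt]
  rcases lt_trichotomy x₀.1 q.1 with h4 | h4 | h4
  · have hne : (q.1 - p.1) * (x₀.2 - p.2) - (q.2 - p.2) * (x₀.1 - p.1) ≠ 0 := fun h =>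
      hx₀ (mem_segment_of_cross_eq_zero h1 h4 h)
    rcases lt_or_gt_of_ne hne with h2 | h2
    · have h3 := mul_neg_of_pos_of_neg hd h2
      filter_upwards [hneg h3, eventually_fst_lt h4, eventually_lt_fst h1] with x hx hx2 hx3
      simp [h3, hx, h1.le, h1.ne', h4, h4.ne, hx2, hx3.le]
    · have h3 := mul_pos hd h2
      filter_upwards [hpos h3] with x hx
      simp [h3.not_gt, hx.not_gt, h1.ne', h4.ne]
  · have hne : x₀.2 ≠ q.2 := fun h => hx₀ (by
      rw [show x₀ = q from Prod.ext h4 h]; exact right_mem_segment ℝ p q)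
    rcases lt_or_gt_of_ne hne with h2 | h2
    · have h3 : (q.1 - p.1) * ((q.1 - p.1) * (x₀.2 - p.2) - (q.2 - p.2) * (x₀.1 - p.1)) < 0 := by
        rw [h4]; nlinarith [mul_pos hd hd]
      filter_upwards [hneg h3, eventually_lt_fst h1] with x hx hx2
      by_cases hx3 : x.1 < q.1
      · simp [h4, h2, hx3, hx2.le, hx, hpq.not_gt, hpq.ne']
      · simp [h4, h2, hx3, hx2.not_gt, hpq.not_gt, hpq.ne']
    · have h3 : 0 < (q.1 - p.1) * ((q.1 - p.1) * (x₀.2 - p.2) - (q.2 - p.2) * (x₀.1 - p.1)) := by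
        rw [h4]; nlinarith [mul_pos hd hd]
      filter_upwards [hpos h3] with x hx
      simp [h3.not_gt, hx.not_gt, h1.ne', h2.not_gt]
  · filter_upwards [eventually_lt_fst h4] with x hx
    simp [h4.not_gt, hx.not_gt, (hpq.trans hx).not_gt, h1.not_gt, h1.ne', h4.ne']

theorem mem_segment_of_fst_eq {p q x : ℝ × ℝ} (h1 : x.1 = p.1) (h2 : p.1 = q.1)
    (h3 : p.2 ≤ x.2) (h4 : x.2 ≤ q.2) : x ∈ segment ℝ p q := by
  have : x.2 ∈ segment ℝ p.2 q.2 := by rw [segment_eq_Icc (h3.trans h4)]; exact ⟨h3, h4⟩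
  obtain ⟨a, b, ha, hb, hab, h⟩ := this
  refine ⟨a, b, ha, hb, hab, Prod.ext ?_ h⟩
  simp [← h2, ← add_mul, hab, h1]

theorem eventually_belowSegment {p q x₀ : ℝ × ℝ} (hx₀ : x₀ ∉ segment ℝ p q) :
    ∀ᶠ x in 𝓝 x₀, belowSegment p q x = belowSegment p q x₀ + rayJump p x₀ x + rayJump q x₀ x := by
  rcases lt_trichotomy p.1 q.1 with h | h | h
  · exact eventually_belowSegment_of_lt h hx₀
  · refine Eventually.of_forall fun x => ?_
    have hb (y) : belowSegment p q y = 0 := by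
      unfold belowSegment; rw [if_neg]; rintro ⟨_, h'⟩; simp [h] at h'
    rw [hb, hb, zero_add]
    by_cases h1 : x₀.1 = q.1
    -- A point on the line of a vertical segment, but off the segment, is below both ends or
    -- neither; hence the two ray jumps cancel.
    · have h2 : x₀.2 < p.2 ↔ x₀.2 < q.2 := by
        constructor <;> intro h2 <;> by_contra! h3
        · rw [segment_symm] at hx₀
          exact hx₀ (mem_segment_of_fst_eq h1 h.symm h3 h2.le)
        · exact hx₀ (mem_segment_of_fst_eq (h1.trans h.symm) h h3 h2.le)
      simp only [rayJump, h, h2, ZMod.add_self_two]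
    · simp [rayJump, h, h1]
  · rw [segment_symm] at hx₀
    filter_upwards [eventually_belowSegment_of_lt h hx₀] with x hx
    rw [belowSegment_comm p q x, belowSegment_comm p q x₀, hx]; ring

/-- The term `if 0 < r` records the crossing of the segment. If the segment is vertical, its
indicator vanishes and the interior points lie on the ray below the upper end only, so that the ray
jump is cancelled by the crossing term up to the constant. -/
theorem eventually_belowSegment_openSegment {p q : ℝ × ℝ} (hpq : p ≠ q) {t : ℝ} (ht0 : 0 < t)
    (ht1 : t < 1) : ∃ c : ZMod 2, ∀ᶠ r : ℝ in 𝓝 0, r ≠ 0 →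
      belowSegment p q (p + t • (q - p) + r • leftNormal (q - p)) =
        c + (if 0 < r then 1 else 0) +
        rayJump p (p + t • (q - p)) (p + t • (q - p) + r • leftNormal (q - p)) +
        rayJump q (p + t • (q - p)) (p + t • (q - p) + r • leftNormal (q - p)) := by
  by_cases h : p.1 = q.1
  · have hb (y) : belowSegment p q y = 0 := by
      unfold belowSegment; rw [if_neg]; rintro ⟨_, h'⟩; simp [h] at h'
    have hne : p.2 ≠ q.2 := fun h2 => hpq (Prod.ext h h2)
    rcases lt_or_gt_of_ne hne with h2 | h2
    · refine ⟨0, Eventually.of_forall fun r hr => ?_⟩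
      have h3 : ¬ p.2 + t * (q.2 - p.2) < p.2 := by nlinarith
      have h4 : p.2 + t * (q.2 - p.2) < q.2 := by nlinarith
      have h5 : r * (p.2 - q.2) < 0 ↔ 0 < r := by
        constructor <;> intro h6
        · by_contra h7; nlinarith
        · nlinarith
      simp only [hb, rayJump, leftNormal]
      simp [h, h4, h5]
      split_ifs <;> simp [ZMod.add_self_two] <;> nlinarith
    · refine ⟨1, Eventually.of_forall fun r hr => ?_⟩
      have h3 : ¬ p.2 + t * (q.2 - p.2) < q.2 := by nlinarith
      have h4 : p.2 + t * (q.2 - p.2) < p.2 := by nlinarith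
      have h5 : r * (p.2 - q.2) < 0 ↔ ¬ 0 < r := by
        constructor <;> intro h6
        · intro h7; nlinarith
        · have := lt_of_le_of_ne (not_lt.1 h6) hr
          nlinarith
      simp only [hb, rayJump, leftNormal]
      simp [h, h3, h4, h5]
      split_ifs <;> first | (exfalso; linarith) | simp [ZMod.add_self_two]
  · have hu : 0 < (q.1 - p.1) ^ 2 + (q.2 - p.2) ^ 2 := by
      have := sub_ne_zero.2 (Ne.symm h); positivity
    have hp : p.1 + t * (q.1 - p.1) ≠ p.1 := by
      simpa [ht0.ne', sub_eq_zero] using Ne.symm h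
    have hq : p.1 + t * (q.1 - p.1) ≠ q.1 := by
      intro h'
      have : (1 - t) * (q.1 - p.1) = 0 := by linarith
      rcases mul_eq_zero.1 this with h'' | h''
      · linarith
      · exact h (by linarith)
    have hcont : Continuous fun r : ℝ => p.1 + t * (q.1 - p.1) + r * -(q.2 - p.2) := by fun_prop
    have hc0 : p.1 + t * (q.1 - p.1) + 0 * -(q.2 - p.2) = p.1 + t * (q.1 - p.1) := by ring
    -- The left side of the segment, `0 < r`, is above it exactly when `p.1 < q.1`; in that case the
    -- right side has value 1.
    refine ⟨if p.1 < q.1 then 1 else 0, ?_⟩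
    have hcross (r : ℝ) : (q.1 - p.1) * ((q.1 - p.1) * (p.2 + t * (q.2 - p.2) + r * (q.1 - p.1) - p.2)
        - (q.2 - p.2) * (p.1 + t * (q.1 - p.1) + r * -(q.2 - p.2) - p.1)) =
        (q.1 - p.1) * r * ((q.1 - p.1) ^ 2 + (q.2 - p.2) ^ 2) := by ring
    rcases lt_or_gt_of_ne h with h2 | h2
    · have e1 : ∀ᶠ r : ℝ in 𝓝 0, p.1 < p.1 + t * (q.1 - p.1) + r * -(q.2 - p.2) :=
        hcont.continuousAt.eventually_const_lt (by simp only [hc0]; nlinarith)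
      have e2 : ∀ᶠ r : ℝ in 𝓝 0, p.1 + t * (q.1 - p.1) + r * -(q.2 - p.2) < q.1 :=
        hcont.continuousAt.eventually_lt_const (by simp only [hc0]; nlinarith)
      filter_upwards [e1, e2] with r h3 h4 hr
      have h5 : (q.1 - p.1) * r * ((q.1 - p.1) ^ 2 + (q.2 - p.2) ^ 2) < 0 ↔ ¬ 0 < r := by
        have h6 : 0 < q.1 - p.1 := by linarith
        rw [← neg_pos, ← neg_mul, mul_pos_iff_of_pos_right hu, ← mul_neg,
          mul_pos_iff_of_pos_left h6, neg_pos, not_lt]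
        exact ⟨le_of_lt, fun h => lt_of_le_of_ne h hr⟩
      simp only [belowSegment, rayJump, leftNormal, Prod.fst_add, Prod.snd_add, Prod.smul_fst,
        Prod.smul_snd, Prod.fst_sub, Prod.snd_sub, smul_eq_mul, hp, hq, hcross, h5, h3.le, h4, h2]
      simp
      split_ifs <;> first | (exfalso; linarith) | simp [ZMod.add_self_two]
    · have e1 : ∀ᶠ r : ℝ in 𝓝 0, q.1 < p.1 + t * (q.1 - p.1) + r * -(q.2 - p.2) :=
        hcont.continuousAt.eventually_const_lt (by simp only [hc0]; nlinarith)
      have e2 : ∀ᶠ r : ℝ in 𝓝 0, p.1 + t * (q.1 - p.1) + r * -(q.2 - p.2) < p.1 :=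
        hcont.continuousAt.eventually_lt_const (by simp only [hc0]; nlinarith)
      filter_upwards [e1, e2] with r h3 h4 hr
      have h5 : (q.1 - p.1) * r * ((q.1 - p.1) ^ 2 + (q.2 - p.2) ^ 2) < 0 ↔ 0 < r := by
        have h6 : q.1 - p.1 < 0 := by linarith
        rw [← neg_pos, ← neg_mul, mul_pos_iff_of_pos_right hu, ← neg_mul,
          mul_pos_iff_of_pos_left (neg_pos.2 h6)]
      simp only [belowSegment, rayJump, leftNormal, Prod.fst_add, Prod.snd_add, Prod.smul_fst,
        Prod.smul_snd, Prod.fst_sub, Prod.snd_sub, smul_eq_mul, hp, hq, hcross, h5, h3.le, h4,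
        not_lt.2 h2.le]
      simp

theorem mem_openSegment_of_lt_one {p q : ℝ × ℝ} {t : ℝ} (ht0 : 0 < t) (ht1 : t < 1) :
    p + t • (q - p) ∈ openSegment ℝ p q :=
  ⟨1 - t, t, by linarith, ht0, by ring, by rw [sub_smul, smul_sub, one_smul]; abel⟩

theorem add_smul_sub_ne {p q : ℝ × ℝ} (hpq : p ≠ q) {t : ℝ} (ht1 : t < 1) :
    p + t • (q - p) ≠ q := by
  intro h
  have : (1 - t) • (q - p) = 0 := by
    rw [sub_smul, one_smul, sub_sub, sub_eq_zero]; exact h.symm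
  rcases smul_eq_zero.1 this with h' | h'
  · linarith
  · exact hpq (sub_eq_zero.1 h').symm

/-- A function modulo 2 attached to an arc, which jumps when the arc is crossed and, apart from
that, only when one of the downward vertical rays from the ends of the arc is crossed. -/
theorem IsPolygonalArc.exists_parity {A : Set (ℝ × ℝ)} {p q : ℝ × ℝ} (hA : IsPolygonalArc A p q) :
    ∃ f : ℝ × ℝ → ZMod 2,
      (∀ x₀ ∉ A, ∀ᶠ x in 𝓝 x₀, f x = f x₀ + rayJump p x₀ x + rayJump q x₀ x) ∧
      ∃ q', p ≠ q' ∧ segment ℝ p q' ⊆ A ∧ ∀ t : ℝ, 0 < t → t < 1 → ∃ c : ZMod 2,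
        ∀ᶠ r : ℝ in 𝓝 0, r ≠ 0 → f (p + t • (q' - p) + r • leftNormal (q' - p)) =
          c + (if 0 < r then 1 else 0) +
          rayJump p (p + t • (q' - p)) (p + t • (q' - p) + r • leftNormal (q' - p)) +
          rayJump q (p + t • (q' - p)) (p + t • (q' - p) + r • leftNormal (q' - p)) := by
  induction hA with
  | single p q hpq =>
    exact ⟨belowSegment p q, fun x₀ hx₀ => eventually_belowSegment hx₀, q, hpq, subset_rfl,
      fun t ht0 ht1 => eventually_belowSegment_openSegment hpq ht0 ht1⟩
  | cons p q r A hpq hA hinter ih =>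
    obtain ⟨f, hf, -⟩ := ih
    refine ⟨fun x => belowSegment p q x + f x, fun x₀ hx₀ => ?_, q, hpq, Set.subset_union_left,
      fun t ht0 ht1 => ?_⟩
    · rw [Set.mem_union, not_or] at hx₀
      filter_upwards [hf x₀ hx₀.2, eventually_belowSegment hx₀.1] with x h1 h2
      rw [h1, h2]
      -- The ray below the joint is counted once by each of the two pieces and cancels modulo 2.
      linear_combination ZMod.add_self_two (rayJump q x₀ x)
    · obtain ⟨c, hc⟩ := eventually_belowSegment_openSegment hpq ht0 ht1
      have hm : p + t • (q - p) ∉ A := fun h => add_smul_sub_ne hpq ht1 (by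
        have : p + t • (q - p) ∈ segment ℝ p q ∩ A :=
          ⟨openSegment_subset_segment _ _ _ (mem_openSegment_of_lt_one ht0 ht1), h⟩
        rwa [hinter] at this)
      have hcont : Continuous fun r : ℝ => p + t • (q - p) + r • leftNormal (q - p) := by fun_prop
      have := hcont.tendsto' 0 (p + t • (q - p)) (by simp)
      refine ⟨c + f (p + t • (q - p)), ?_⟩
      filter_upwards [hc, this.eventually (hf _ hm)] with r h1 h2 hr
      rw [h1 hr, h2]
      linear_combination ZMod.add_self_two (rayJump q (p + t • (q - p)) (p + t • (q - p) + r • leftNormal (q - p)))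

/-! ### Sides of segments and locally constant functions -/

/-- The cross product of two plane vectors. -/
def planeCross (u v : ℝ × ℝ) : ℝ := u.1 * v.2 - u.2 * v.1

/-- The germ at `p` of thin sectors that are bounded by the ray from `p` in direction `u` and lie on
the side of it to which `n` points. -/
noncomputable def sideFilter (p u n : ℝ × ℝ) : Filter (ℝ × ℝ) :=
  Filter.map (fun z : ℝ × ℝ => p + z.1 • (u + z.2 • n)) (𝓝[>] (0 : ℝ) ×ˢ 𝓝[>] (0 : ℝ))

instance sideFilter_neBot (p u n : ℝ × ℝ) : (sideFilter p u n).NeBot := by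
  unfold sideFilter; infer_instance

theorem sideFilter_le_nhds (p u n : ℝ × ℝ) : sideFilter p u n ≤ 𝓝 p := by
  have : Continuous fun z : ℝ × ℝ => p + z.1 • (u + z.2 • n) := by fun_prop
  have h := this.tendsto' (0, 0) p (by simp)
  refine le_trans (Filter.map_mono ?_) h
  rw [nhds_prod_eq]
  exact Filter.prod_mono nhdsWithin_le_nhds nhdsWithin_le_nhds

theorem tendsto_const_mul_nhdsGT_zero {a : ℝ} (ha : 0 < a) :
    Tendsto (fun t : ℝ => a * t) (𝓝[>] 0) (𝓝[>] 0) := by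
  have hc : Continuous fun t : ℝ => a * t := by fun_prop
  refine tendsto_nhdsWithin_iff.2 ⟨(hc.tendsto' 0 0 (by simp)).mono_left nhdsWithin_le_nhds, ?_⟩
  filter_upwards [self_mem_nhdsWithin] with t ht
  exact mul_pos ha ht

theorem sideFilter_smul (p u n : ℝ × ℝ) {a : ℝ} (ha : 0 < a) :
    sideFilter p (a • u) (a • n) = sideFilter p u n := by
  have key (b : ℝ) (hb : 0 < b) (u n : ℝ × ℝ) : sideFilter p (b • u) (b • n) ≤ sideFilter p u n := by
    have h : Tendsto (fun z : ℝ × ℝ => (b * z.1, z.2)) (𝓝[>] (0 : ℝ) ×ˢ 𝓝[>] (0 : ℝ))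
        (𝓝[>] (0 : ℝ) ×ˢ 𝓝[>] (0 : ℝ)) :=
      ((tendsto_const_mul_nhdsGT_zero hb).comp tendsto_fst).prodMk tendsto_snd
    refine le_trans (le_of_eq ?_) (Filter.map_mono h)
    rw [Filter.map_map]
    unfold sideFilter
    congr 1
    funext z
    simp [smul_add, smul_smul, mul_comm, mul_left_comm]
  refine le_antisymm (key a ha u n) ?_
  have := key a⁻¹ (inv_pos.2 ha) (a • u) (a • n)
  rwa [inv_smul_smul₀ ha.ne', inv_smul_smul₀ ha.ne'] at this

/-- `W` is locally constant off `Z`. -/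
def LocallyConstantOff (W : ℝ × ℝ → ZMod 2) (Z : Set (ℝ × ℝ)) : Prop :=
  ∀ x ∉ Z, ∀ᶠ y in 𝓝 x, W y = W x

theorem LocallyConstantOff.exists_eq {W : ℝ × ℝ → ZMod 2} {Z : Set (ℝ × ℝ)}
    (hW : LocallyConstantOff W Z) {X : Type*} [TopologicalSpace X] {T : Set X}
    (hT : IsPreconnected T) {g : X → ℝ × ℝ} (hg : Continuous g) (h : ∀ x ∈ T, g x ∉ Z) :
    ∃ c, ∀ x ∈ T, W (g x) = c := by
  let _ : TopologicalSpace (ZMod 2) := ⊥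
  have _ : DiscreteTopology (ZMod 2) := ⟨rfl⟩
  have hc : ContinuousOn (W ∘ g) T := fun x hx => by
    apply ContinuousAt.continuousWithinAt
    change Tendsto _ _ (𝓝 _)
    rw [nhds_discrete (ZMod 2), tendsto_pure]
    exact hg.continuousAt.eventually (hW _ (h x hx))
  rcases T.eq_empty_or_nonempty with rfl | ⟨y, hy⟩
  · exact ⟨0, by simp⟩
  · exact ⟨W (g y), fun x hx => hT.constant hc hx hy⟩

/-- `u` is a direction in which the set `A` leaves the point `p`: near `p`, the set `A` is the ray
from `p` with direction `u`. -/
def IsInitialDirection (A : Set (ℝ × ℝ)) (p u : ℝ × ℝ) : Prop :=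
  u ≠ 0 ∧ ∀ᶠ x in 𝓝 p, x ∈ A ↔ ∃ t : ℝ, 0 ≤ t ∧ x = p + t • u

theorem IsInitialDirection.congr {A B : Set (ℝ × ℝ)} {p u : ℝ × ℝ} (h : IsInitialDirection A p u)
    (hAB : ∀ᶠ x in 𝓝 p, x ∈ A ↔ x ∈ B) : IsInitialDirection B p u :=
  ⟨h.1, by filter_upwards [h.2, hAB] with x h1 h2; rw [← h2, h1]⟩

theorem tendsto_add_smul_nhds_zero (p u : ℝ × ℝ) :
    Tendsto (fun t : ℝ => p + t • u) (𝓝[>] 0) (𝓝 p) := by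
  have : Continuous fun t : ℝ => p + t • u := by fun_prop
  exact (this.tendsto' 0 p (by simp)).mono_left nhdsWithin_le_nhds

theorem IsInitialDirection.eventually_mem {A : Set (ℝ × ℝ)} {p u : ℝ × ℝ}
    (h : IsInitialDirection A p u) : ∀ᶠ t : ℝ in 𝓝[>] 0, p + t • u ∈ A := by
  filter_upwards [(tendsto_add_smul_nhds_zero p u).eventually h.2, self_mem_nhdsWithin] with t ht h0
  exact ht.2 ⟨t, le_of_lt h0, rfl⟩

/-- If the ray from `p` in direction `v` starts inside `A`, its direction is that of `A` at `p`. -/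
theorem IsInitialDirection.exists_eq_smul {A : Set (ℝ × ℝ)} {p u v : ℝ × ℝ}
    (h : IsInitialDirection A p u) (hv : v ≠ 0) (hvA : ∃ᶠ t : ℝ in 𝓝[>] 0, p + t • v ∈ A) :
    ∃ a : ℝ, 0 < a ∧ v = a • u := by
  obtain ⟨t, hmem, ht, h0⟩ := (hvA.and_eventually
    (((tendsto_add_smul_nhds_zero p v).eventually h.2).and self_mem_nhdsWithin)).exists
  obtain ⟨s, hs, hst⟩ := ht.1 hmem
  have h0 : 0 < t := h0
  have hst : t • v = s • u := add_left_cancel hst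
  have hv' : v = (s / t) • u := by
    rw [div_eq_inv_mul, mul_smul, ← hst, smul_smul, inv_mul_cancel₀ h0.ne', one_smul]
  refine ⟨s / t, lt_of_le_of_ne (by positivity) fun h' => hv ?_, hv'⟩
  rw [hv', ← h', zero_smul]

/-- If `v` is not parallel to `u`, then neither is it parallel to `u + s • n` for small `s`. If it
is, then `n` is not parallel to `v`, and `u + s • n` is parallel to `v` only for `s = 0`. -/
theorem IsInitialDirection.eventually_sideFilter {A : Set (ℝ × ℝ)} {p v : ℝ × ℝ}
    (h : IsInitialDirection A p v) {u n : ℝ × ℝ} (hun : planeCross u n ≠ 0) :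
    ∀ᶠ x in sideFilter p u n, x ∉ A := by
  have h1 := (sideFilter_le_nhds p u n) h.2
  have h2 : ∀ᶠ s : ℝ in 𝓝[>] 0, planeCross u v + s * planeCross n v ≠ 0 := by
    by_cases huv : planeCross u v = 0
    · have hnv : planeCross n v ≠ 0 := fun hnv => h.1 (by
        unfold planeCross at *
        ext
        · refine (mul_eq_zero.1 (?_ : v.1 * (u.1 * n.2 - u.2 * n.1) = 0)).resolve_right hun
          linear_combination n.1 * huv - u.1 * hnv
        · refine (mul_eq_zero.1 (?_ : v.2 * (u.1 * n.2 - u.2 * n.1) = 0)).resolve_right hun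
          linear_combination n.2 * huv - u.2 * hnv)
      filter_upwards [self_mem_nhdsWithin] with s hs
      rw [huv, zero_add]
      exact mul_ne_zero (ne_of_gt hs) hnv
    · have hc : Continuous fun s : ℝ => planeCross u v + s * planeCross n v := by fun_prop
      exact nhdsWithin_le_nhds ((hc.tendsto' 0 _ (by simp)).eventually_ne huv)
  simp only [sideFilter, Filter.mem_map, Filter.eventually_map] at h1 ⊢
  have h3 : ∀ᶠ z : ℝ × ℝ in 𝓝[>] (0 : ℝ) ×ˢ 𝓝[>] (0 : ℝ),
      0 < z.1 ∧ planeCross u v + z.2 * planeCross n v ≠ 0 :=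
    (Filter.Eventually.prod_inl self_mem_nhdsWithin _).and (h2.prod_inr _)
  filter_upwards [h1, h3] with z hz ⟨hz1, hz2⟩ hA
  obtain ⟨t, ht, hzt⟩ := hz.1 hA
  have hzt : z.1 • (u + z.2 • n) = t • v := add_left_cancel hzt
  have e1 : z.1 * (u.1 + z.2 * n.1) = t * v.1 := congrArg Prod.fst hzt
  have e2 : z.1 * (u.2 + z.2 * n.2) = t * v.2 := congrArg Prod.snd hzt
  refine hz2 ((mul_eq_zero.1 (?_ : z.1 * _ = 0)).resolve_left hz1.ne')
  unfold planeCross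
  linear_combination v.2 * e1 - v.1 * e2

theorem eventually_sideFilter_of_notMem {K : Set (ℝ × ℝ)} (hK : IsClosed K) {p : ℝ × ℝ}
    (hp : p ∉ K) (u n : ℝ × ℝ) : ∀ᶠ x in sideFilter p u n, x ∉ K :=
  sideFilter_le_nhds p u n (hK.isOpen_compl.mem_nhds hp)

theorem planeCross_leftNormal_ne_zero {u : ℝ × ℝ} (hu : u ≠ 0) : planeCross u (leftNormal u) ≠ 0 := by
  intro h
  simp only [planeCross, leftNormal] at h
  apply hu
  ext <;> simp <;> nlinarith [sq_nonneg u.1, sq_nonneg u.2]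

theorem leftNormal_smul (a : ℝ) (u : ℝ × ℝ) : leftNormal (a • u) = a • leftNormal u := by
  ext <;> simp [leftNormal]

theorem leftNormal_neg (u : ℝ × ℝ) : leftNormal (-u) = -leftNormal u := by
  ext <;> simp [leftNormal]

theorem IsPolygonalArc.isCompact {A : Set (ℝ × ℝ)} {p q : ℝ × ℝ} (hA : IsPolygonalArc A p q) :
    IsCompact A := by
  have h (p q : ℝ × ℝ) : IsCompact (segment ℝ p q) := by
    rw [segment_eq_image_lineMap]
    exact isCompact_Icc.image AffineMap.lineMap_continuous
  induction hA with
  | single p q _ => exact h p q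
  | cons p q r A _ _ _ ih => exact (h p q).union ih

theorem IsPolygonalArc.left_mem {A : Set (ℝ × ℝ)} {p q : ℝ × ℝ} (hA : IsPolygonalArc A p q) :
    p ∈ A := by
  cases hA with
  | single => exact left_mem_segment ℝ p q
  | cons => exact Or.inl (left_mem_segment ℝ _ _)

theorem IsPolygonalArc.right_mem {A : Set (ℝ × ℝ)} {p q : ℝ × ℝ} (hA : IsPolygonalArc A p q) :
    q ∈ A := by
  induction hA with
  | single => exact right_mem_segment ℝ _ _
  | cons _ _ _ _ _ _ _ ih => exact Or.inr ih

theorem IsPolygonalArc.ne {A : Set (ℝ × ℝ)} {p q : ℝ × ℝ} (hA : IsPolygonalArc A p q) : p ≠ q := by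
  cases hA with
  | single _ _ h => exact h
  | cons _ q' _ A hpq hA hinter =>
    rintro rfl
    have : p ∈ segment ℝ p q' ∩ A := ⟨left_mem_segment ℝ _ _, hA.right_mem⟩
    rw [hinter] at this
    exact hpq this

theorem isInitialDirection_segment {p q : ℝ × ℝ} (hpq : p ≠ q) :
    IsInitialDirection (segment ℝ p q) p (q - p) := by
  have hu : 0 < ‖q - p‖ := norm_pos_iff.2 (sub_ne_zero.2 hpq.symm)
  refine ⟨sub_ne_zero.2 hpq.symm, ?_⟩
  filter_upwards [Metric.ball_mem_nhds p hu] with x hx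
  rw [segment_eq_image']
  constructor
  · rintro ⟨t, ht, rfl⟩
    exact ⟨t, ht.1, rfl⟩
  · rintro ⟨t, ht, rfl⟩
    refine ⟨t, ⟨ht, ?_⟩, rfl⟩
    rw [Metric.mem_ball, dist_eq_norm, add_sub_cancel_left, norm_smul, Real.norm_of_nonneg ht] at hx
    by_contra! h
    nlinarith

theorem IsPolygonalArc.exists_isInitialDirection {A : Set (ℝ × ℝ)} {p q : ℝ × ℝ}
    (hA : IsPolygonalArc A p q) : ∃ u, IsInitialDirection A p u := by
  cases hA with
  | single _ _ h => exact ⟨_, isInitialDirection_segment h⟩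
  | cons _ q' _ A hpq hA hinter =>
    refine ⟨q' - p, (isInitialDirection_segment hpq).congr ?_⟩
    have hp : p ∉ A := fun h => hpq (by
      have : p ∈ segment ℝ p q' ∩ A := ⟨left_mem_segment ℝ _ _, h⟩
      rwa [hinter] at this)
    filter_upwards [hA.isCompact.isClosed.isOpen_compl.mem_nhds hp] with x hx
    simp [show x ∉ A from hx]

/-- A thin triangle over the segment avoids `Z`: near the ends by the assumptions on the two germs,
over the middle by compactness. It is convex, so `W` is constant on it, and both germs lie
eventually in it. -/
theorem LocallyConstantOff.exists_sideFilter_segment {W : ℝ × ℝ → ZMod 2} {Z : Set (ℝ × ℝ)}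
    (hW : LocallyConstantOff W Z) {K : Set (ℝ × ℝ)} (hK : IsClosed K) {p q n : ℝ × ℝ}
    (hZ : Z ⊆ K ∪ segment ℝ p q) (hn : planeCross (q - p) n ≠ 0)
    (hKo : ∀ x ∈ openSegment ℝ p q, x ∉ K)
    (hp : ∀ᶠ x in sideFilter p (q - p) n, x ∉ K) (hq : ∀ᶠ x in sideFilter q (p - q) n, x ∉ K) :
    ∃ c, (∀ᶠ x in sideFilter p (q - p) n, W x = c) ∧ (∀ᶠ x in sideFilter q (p - q) n, W x = c) := by
  have hb := (nhdsGT_basis (0 : ℝ)).prod_self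
  obtain ⟨ε₁, hε₁, h1⟩ := hb.eventually_iff.1 (Filter.eventually_map.1 hp)
  obtain ⟨ε₂, hε₂, h2⟩ := hb.eventually_iff.1 (Filter.eventually_map.1 hq)
  set δ := min ε₁ ε₂ / 2
  have hδ : 0 < δ := by positivity
  have hδ1 : δ < ε₁ := (half_lt_self (lt_min hε₁ hε₂)).trans_le (min_le_left _ _)
  have hδ2 : δ < ε₂ := (half_lt_self (lt_min hε₁ hε₂)).trans_le (min_le_right _ _)
  have hg : Continuous fun z : ℝ × ℝ => p + z.1 • (q - p) + z.2 • n := by fun_prop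
  have hmid : ∀ᶠ r : ℝ in 𝓝 0, ∀ s ∈ Set.Icc δ (1 - δ), p + s • (q - p) + r • n ∉ K := by
    refine isCompact_Icc.eventually_forall_of_forall_eventually fun s hs => ?_
    have hs' : p + s • (q - p) + (0 : ℝ) • n ∉ K := by
      rw [zero_smul, add_zero]
      exact hKo _ (mem_openSegment_of_lt_one (hδ.trans_le hs.1) (by linarith [hs.2]))
    have hc : Continuous fun z : ℝ × ℝ => p + z.2 • (q - p) + z.1 • n := by fun_prop
    exact (hc.tendsto ((0 : ℝ), s)).eventually (hK.isOpen_compl.mem_nhds hs')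
  obtain ⟨η, hη, hmid⟩ := (nhdsGT_basis (0 : ℝ)).eventually_iff.1 (nhdsWithin_le_nhds hmid)
  set ε := min (min ε₁ ε₂) η
  have hε : 0 < ε := lt_min (lt_min hε₁ hε₂) hη
  -- Here `z.1` runs along the segment and `z.2` in the direction of `n`; the slope `ε` is small
  -- enough for both end sectors and for the strip of height `η` over the middle.
  set T : Set (ℝ × ℝ) := {z | 0 < z.2 ∧ z.2 < ε * z.1 ∧ z.2 < ε * (1 - z.1)}
  have hT : Convex ℝ T := by
    rintro ⟨a, b⟩ ⟨ha1, ha2, ha3⟩ ⟨c, d⟩ ⟨hc1, hc2, hc3⟩ x y hx hy hxy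
    simp only [T, Set.mem_ofPred_eq, Prod.smul_mk, Prod.mk_add_mk, smul_eq_mul] at *
    have hy' : y = 1 - x := by linarith
    subst hy'
    rcases hx.eq_or_lt with rfl | hx
    · simpa using ⟨hc1, hc2, hc3⟩
    · refine ⟨?_, ?_, ?_⟩ <;> nlinarith
  have hTK : ∀ z ∈ T, p + z.1 • (q - p) + z.2 • n ∉ Z := by
    rintro ⟨s, r⟩ ⟨hr, hr1, hr2⟩ hz
    simp only at hr hr1 hr2 hz
    have hs0 : 0 < s := pos_of_mul_pos_right (hr.trans hr1) hε.le
    have hs1 : 0 < 1 - s := pos_of_mul_pos_right (hr.trans hr2) hε.le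
    rcases hZ hz with hzK | hzs
    · rcases lt_or_ge s δ with h | h
      · refine @h1 (s, r / s) ⟨⟨hs0, h.trans hδ1⟩, ⟨by positivity, ?_⟩⟩ ?_
        · rw [div_lt_iff₀ hs0]
          exact hr1.trans_le (mul_le_mul_of_nonneg_right
            ((min_le_left _ _).trans (min_le_left _ _)) hs0.le)
        · convert hzK using 1
          simp only [smul_add, smul_smul, mul_div_cancel₀ _ hs0.ne', add_assoc]
      rcases lt_or_ge (1 - s) δ with h' | h'
      · refine @h2 (1 - s, r / (1 - s)) ⟨⟨hs1, h'.trans hδ2⟩, ⟨by positivity, ?_⟩⟩ ?_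
        · rw [div_lt_iff₀ hs1]
          exact hr2.trans_le (mul_le_mul_of_nonneg_right
            ((min_le_left _ _).trans (min_le_right _ _)) hs1.le)
        · convert hzK using 1
          simp only [smul_add, smul_smul, mul_div_cancel₀ _ hs1.ne']
          module
      · refine hmid ⟨hr, ?_⟩ s ⟨h, by linarith⟩ hzK
        have : ε * s ≤ η * 1 := mul_le_mul (min_le_right _ _) (by linarith) hs0.le hη.le
        linarith
    · rw [segment_eq_image'] at hzs
      obtain ⟨t, -, ht⟩ := hzs
      have e1 := congrArg Prod.fst ht
      have e2 := congrArg Prod.snd ht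
      simp only [planeCross, Prod.fst_add, Prod.snd_add, Prod.smul_fst, Prod.smul_snd, Prod.fst_sub,
        Prod.snd_sub, smul_eq_mul] at e1 e2 hn
      refine hn ((mul_eq_zero.1 (?_ : r * _ = 0)).resolve_left hr.ne')
      linear_combination (q.2 - p.2) * e1 - (q.1 - p.1) * e2
  obtain ⟨c, hc⟩ := hW.exists_eq hT.isPreconnected hg hTK
  have hlim : ∀ᶠ z : ℝ × ℝ in 𝓝[>] (0 : ℝ) ×ˢ 𝓝[>] (0 : ℝ), (0 < z.1 ∧ z.1 < 1 / 2) ∧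
      (0 < z.2 ∧ z.2 < ε) :=
    (Filter.Eventually.prod_inl (Ioo_mem_nhdsGT (by norm_num)) _).and
      (Filter.Eventually.prod_inr (Ioo_mem_nhdsGT hε) _)
  refine ⟨c, ?_, ?_⟩
  · refine Filter.eventually_map.2 ?_
    filter_upwards [hlim] with z ⟨⟨h3, h4⟩, h5, h6⟩
    rw [← hc (z.1, z.1 * z.2) ⟨mul_pos h3 h5, by simp only; nlinarith, by simp only; nlinarith⟩]
    congr 1
    simp only [smul_add, smul_smul, add_assoc]
  · refine Filter.eventually_map.2 ?_
    filter_upwards [hlim] with z ⟨⟨h3, h4⟩, h5, h6⟩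
    rw [← hc (1 - z.1, z.1 * z.2) ⟨mul_pos h3 h5, by simp only; nlinarith, by simp only; nlinarith⟩]
    congr 1
    simp only
    module

/-! ### Polar angles and clockwise sweeps around a point -/

/-- The unit vector with polar angle `θ`. -/
noncomputable def unitVector (θ : ℝ) : ℝ × ℝ := (Real.cos θ, Real.sin θ)

theorem unitVector_add (θ η : ℝ) : unitVector (θ + η) =
    Real.cos η • unitVector θ + Real.sin η • leftNormal (unitVector θ) := by
  ext <;> simp [unitVector, leftNormal, Real.cos_add, Real.sin_add] <;> ring

/-- The point at distance `t` and angle `η` off the ray has sector coordinates `(t cos η, tan η)`,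
and this change of coordinates respects the limit at the corner. -/
theorem eventually_unitVector_of_sideFilter {b : ℝ × ℝ} {θ : ℝ} {P : ℝ × ℝ → Prop} {σ : ℝ}
    (hσ : σ = 1 ∨ σ = -1)
    (h : ∀ᶠ x in sideFilter b (unitVector θ) (σ • leftNormal (unitVector θ)), P x) :
    ∀ᶠ z : ℝ × ℝ in 𝓝[>] 0 ×ˢ 𝓝[>] 0, P (b + z.1 • unitVector (θ + σ * z.2)) := by
  have hη : ∀ᶠ η : ℝ in 𝓝[>] 0, 0 < η ∧ η < Real.pi / 2 := Ioo_mem_nhdsGT (by positivity)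
  have hz : ∀ᶠ z : ℝ × ℝ in 𝓝[>] (0 : ℝ) ×ˢ 𝓝[>] (0 : ℝ), 0 < z.1 ∧ 0 < z.2 ∧ z.2 < Real.pi / 2 :=
    (Filter.Eventually.prod_inl self_mem_nhdsWithin _).and (Filter.Eventually.prod_inr hη _)
  have hlim : Tendsto (fun z : ℝ × ℝ => (z.1 * Real.cos z.2, Real.tan z.2))
      (𝓝[>] (0 : ℝ) ×ˢ 𝓝[>] (0 : ℝ)) (𝓝[>] (0 : ℝ) ×ˢ 𝓝[>] (0 : ℝ)) := by
    refine Tendsto.prodMk (tendsto_nhdsWithin_iff.2 ⟨?_, ?_⟩) (tendsto_nhdsWithin_iff.2 ⟨?_, ?_⟩)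
    · have hc : Continuous fun z : ℝ × ℝ => z.1 * Real.cos z.2 := by fun_prop
      refine (hc.tendsto' (0, 0) 0 (by simp)).mono_left ?_
      rw [nhds_prod_eq]
      exact Filter.prod_mono nhdsWithin_le_nhds nhdsWithin_le_nhds
    · filter_upwards [hz] with z ⟨h1, h2, h3⟩
      exact mul_pos h1 (Real.cos_pos_of_mem_Ioo ⟨by linarith, h3⟩)
    · have hc : ContinuousAt Real.tan 0 := Real.continuousAt_tan.2 (by simp)
      have := hc.tendsto
      rw [Real.tan_zero] at this
      exact (this.mono_left nhdsWithin_le_nhds).comp tendsto_snd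
    · filter_upwards [hz] with z ⟨h1, h2, h3⟩
      exact Real.tan_pos_of_pos_of_lt_pi_div_two h2 h3
  filter_upwards [hlim.eventually (Filter.eventually_map.1 h), hz] with z h0 ⟨h1, h2, h3⟩
  convert h0 using 2
  have hcos : Real.cos z.2 ≠ 0 := (Real.cos_pos_of_mem_Ioo ⟨by linarith, h3⟩).ne'
  rw [unitVector_add, smul_add, smul_add, smul_smul, smul_smul, smul_smul, smul_smul]
  congr 2
  · rcases hσ with rfl | rfl <;> simp
  · rw [mul_assoc z.1, mul_comm (Real.cos _), Real.tan_mul_cos hcos]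
    rcases hσ with rfl | rfl <;> simp

/-- If no point of `Z` near `b` lies in the open sector clockwise from the angle `θ` to `θ - a`,
then the values of `W` on the two inner sides of that sector agree. -/
theorem LocallyConstantOff.eq_of_sector {W : ℝ × ℝ → ZMod 2} {Z : Set (ℝ × ℝ)}
    (hW : LocallyConstantOff W Z) {b : ℝ × ℝ} {θ a : ℝ} (ha : 0 < a)
    (hZ : ∀ᶠ t : ℝ in 𝓝[>] 0, ∀ φ ∈ Set.Ioo (θ - a) θ, b + t • unitVector φ ∉ Z) {c c' : ZMod 2}
    (hc : ∀ᶠ x in sideFilter b (unitVector θ) (-leftNormal (unitVector θ)), W x = c)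
    (hc' : ∀ᶠ x in sideFilter b (unitVector (θ - a)) (leftNormal (unitVector (θ - a))), W x = c') :
    c = c' := by
  obtain ⟨ε, hε, hZ⟩ := (nhdsGT_basis (0 : ℝ)).eventually_iff.1 hZ
  have hg : Continuous fun z : ℝ × ℝ => b + z.1 • unitVector z.2 := by unfold unitVector; fun_prop
  obtain ⟨d, hd⟩ := hW.exists_eq (T := Set.Ioo 0 ε ×ˢ Set.Ioo (θ - a) θ)
    (isPreconnected_Ioo.prod isPreconnected_Ioo) hg (fun z hz => hZ hz.1 z.2 hz.2)
  have h1 := eventually_unitVector_of_sideFilter (σ := -1) (Or.inr rfl) (by simpa using hc)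
  have h2 := eventually_unitVector_of_sideFilter (σ := 1) (Or.inl rfl) (by simpa using hc')
  have h3 : ∀ᶠ z : ℝ × ℝ in 𝓝[>] (0 : ℝ) ×ˢ 𝓝[>] (0 : ℝ), (0 < z.1 ∧ z.1 < ε) ∧
      (0 < z.2 ∧ z.2 < a) :=
    (Filter.Eventually.prod_inl (Ioo_mem_nhdsGT hε) _).and
      (Filter.Eventually.prod_inr (Ioo_mem_nhdsGT ha) _)
  obtain ⟨z, hz1, hz2, ⟨h4, h5⟩, h6, h7⟩ := (h1.and (h2.and h3)).exists
  rw [← hz1, ← hz2, hd (z.1, θ + -1 * z.2) ⟨⟨h4, h5⟩, by simp only; linarith, by simp only; linarith⟩,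
    hd (z.1, θ - a + 1 * z.2) ⟨⟨h4, h5⟩, by simp only; linarith, by simp only; linarith⟩]

/-- The polar angle of a plane vector. -/
noncomputable def planeAngle (u : ℝ × ℝ) : ℝ := Complex.arg ⟨u.1, u.2⟩

theorem exists_eq_smul_unitVector {u : ℝ × ℝ} (hu : u ≠ 0) :
    ∃ ρ : ℝ, 0 < ρ ∧ u = ρ • unitVector (planeAngle u) := by
  refine ⟨‖(⟨u.1, u.2⟩ : ℂ)‖, norm_pos_iff.2 fun h => hu ?_, ?_⟩
  · exact Prod.ext (congrArg Complex.re h) (congrArg Complex.im h)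
  · ext
    · simp [unitVector, planeAngle, Complex.norm_mul_cos_arg]
    · simp [unitVector, planeAngle, Complex.norm_mul_sin_arg]

theorem exists_int_of_smul_unitVector_eq {ρ ρ' θ φ : ℝ} (hρ : 0 < ρ) (hρ' : 0 < ρ')
    (h : ρ • unitVector θ = ρ' • unitVector φ) : ∃ k : ℤ, θ = φ + k * (2 * Real.pi) := by
  have e1 : ρ * Real.cos θ = ρ' * Real.cos φ := congrArg Prod.fst h
  have e2 : ρ * Real.sin θ = ρ' * Real.sin φ := congrArg Prod.snd h
  have e3 : ρ ^ 2 = ρ' ^ 2 := by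
    have h1 := Real.sin_sq_add_cos_sq θ
    have h2 := Real.sin_sq_add_cos_sq φ
    calc ρ ^ 2 = (ρ * Real.cos θ) ^ 2 + (ρ * Real.sin θ) ^ 2 := by linear_combination -ρ ^ 2 * h1
      _ = (ρ' * Real.cos φ) ^ 2 + (ρ' * Real.sin φ) ^ 2 := by rw [e1, e2]
      _ = ρ' ^ 2 := by linear_combination ρ' ^ 2 * h2
  have e4 : ρ = ρ' := (pow_left_inj₀ hρ.le hρ'.le two_ne_zero).1 e3
  subst e4
  have h5 : (θ : Real.Angle) = φ := Real.Angle.cos_sin_inj (mul_left_cancel₀ hρ.ne' e1)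
    (mul_left_cancel₀ hρ.ne' e2)
  obtain ⟨k, hk⟩ := Real.Angle.angle_eq_iff_two_pi_dvd_sub.1 h5
  exact ⟨k, by linear_combination hk⟩

/-- The angle in `(0, 2π]` through which `u` has to be rotated clockwise to point in the direction
of `v`. -/
noncomputable def clockwiseAngle (u v : ℝ × ℝ) : ℝ :=
  toIocMod Real.two_pi_pos 0 (planeAngle u - planeAngle v)

theorem clockwiseAngle_mem (u v : ℝ × ℝ) : clockwiseAngle u v ∈ Set.Ioc 0 (2 * Real.pi) := by
  have := toIocMod_mem_Ioc Real.two_pi_pos 0 (planeAngle u - planeAngle v)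
  rwa [zero_add] at this

theorem exists_int_clockwiseAngle (u v : ℝ × ℝ) :
    ∃ k : ℤ, planeAngle u - planeAngle v = clockwiseAngle u v + k * (2 * Real.pi) :=
  ⟨toIocDiv Real.two_pi_pos 0 (planeAngle u - planeAngle v), by
    have := toIocMod_add_toIocDiv_zsmul Real.two_pi_pos 0 (planeAngle u - planeAngle v)
    rw [zsmul_eq_mul] at this
    exact this.symm⟩

theorem clockwiseAngle_eq {u v : ℝ × ℝ} {a : ℝ} (ha : a ∈ Set.Ioc 0 (2 * Real.pi)) (k : ℤ)
    (h : planeAngle u - planeAngle v = a + k * (2 * Real.pi)) : clockwiseAngle u v = a :=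
  (toIocMod_eq_iff Real.two_pi_pos).2 ⟨by simpa using ha, k, by rw [zsmul_eq_mul]; exact h⟩

theorem unitVector_add_int_mul (θ : ℝ) (k : ℤ) : unitVector (θ + k * (2 * Real.pi)) = unitVector θ := by
  simp [unitVector]

theorem exists_pos_smul_of_planeAngle {u v : ℝ × ℝ} (hu : u ≠ 0) (hv : v ≠ 0) (k : ℤ)
    (h : planeAngle u - planeAngle v = k * (2 * Real.pi)) : ∃ a : ℝ, 0 < a ∧ v = a • u := by
  obtain ⟨ρ, hρ, h1⟩ := exists_eq_smul_unitVector hu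
  obtain ⟨ρ', hρ', h2⟩ := exists_eq_smul_unitVector hv
  have h3 : unitVector (planeAngle u) = unitVector (planeAngle v) := by
    rw [← unitVector_add_int_mul (planeAngle v) k, ← h]; simp
  refine ⟨ρ' / ρ, by positivity, ?_⟩
  rw [h1, smul_smul, div_mul_cancel₀ _ hρ.ne', h3, ← h2]

theorem norm_unitVector_le (θ : ℝ) : ‖unitVector θ‖ ≤ 1 := by
  rw [unitVector, Prod.norm_def]
  exact max_le (Real.abs_cos_le_one θ) (Real.abs_sin_le_one θ)

theorem unitVector_ne_zero (θ : ℝ) : unitVector θ ≠ 0 := by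
  intro h
  have h1 : Real.cos θ = 0 := congrArg Prod.fst h
  have h2 : Real.sin θ = 0 := congrArg Prod.snd h
  have := Real.sin_sq_add_cos_sq θ
  rw [h1, h2] at this
  norm_num at this

theorem eventually_unitVector_of_nhds {b : ℝ × ℝ} {P : ℝ × ℝ → Prop} (h : ∀ᶠ x in 𝓝 b, P x) :
    ∀ᶠ t : ℝ in 𝓝[>] 0, ∀ φ : ℝ, P (b + t • unitVector φ) := by
  obtain ⟨ε, hε, h⟩ := Metric.eventually_nhds_iff.1 h
  filter_upwards [Ioo_mem_nhdsGT hε] with t ht φ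
  apply h
  rw [dist_eq_norm, add_sub_cancel_left, norm_smul, Real.norm_of_nonneg ht.1.le]
  nlinarith [norm_unitVector_le φ, ht.1, ht.2]

theorem IsInitialDirection.eventually_sector {A : Set (ℝ × ℝ)} {b w : ℝ × ℝ}
    (h : IsInitialDirection A b w) {u : ℝ × ℝ} {a : ℝ} (ha : a ≤ clockwiseAngle u w) :
    ∀ᶠ t : ℝ in 𝓝[>] 0, ∀ φ ∈ Set.Ioo (planeAngle u - a) (planeAngle u),
      b + t • unitVector φ ∉ A := by
  filter_upwards [eventually_unitVector_of_nhds h.2, self_mem_nhdsWithin] with t ht ht0 φ hφ hA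
  obtain ⟨s, hs, hst⟩ := (ht φ).1 hA
  have hst : t • unitVector φ = s • w := add_left_cancel hst
  have ht0 : 0 < t := ht0
  rcases hs.eq_or_lt with rfl | hs
  · rw [zero_smul] at hst
    exact (smul_ne_zero ht0.ne' (unitVector_ne_zero φ)) hst
  obtain ⟨ρ, hρ, hw⟩ := exists_eq_smul_unitVector h.1
  rw [hw, smul_smul] at hst
  obtain ⟨k, hk⟩ := exists_int_of_smul_unitVector_eq ht0 (mul_pos hs hρ) hst
  have h1 := clockwiseAngle_mem u w
  have h2 : clockwiseAngle u w = planeAngle u - φ :=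
    clockwiseAngle_eq ⟨by linarith [hφ.2], by linarith [hφ.1, h1.2]⟩ k (by rw [hk]; ring)
  linarith [hφ.1]

theorem LocallyConstantOff.eq_of_clockwise {W : ℝ × ℝ → ZMod 2} {Z : Set (ℝ × ℝ)}
    (hW : LocallyConstantOff W Z) {b u v : ℝ × ℝ} (hu : u ≠ 0) (hv : v ≠ 0)
    (hZ : ∀ᶠ t : ℝ in 𝓝[>] 0, ∀ φ ∈ Set.Ioo (planeAngle u - clockwiseAngle u v) (planeAngle u),
      b + t • unitVector φ ∉ Z) {c c' : ZMod 2}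
    (hc : ∀ᶠ x in sideFilter b u (-leftNormal u), W x = c)
    (hc' : ∀ᶠ x in sideFilter b v (leftNormal v), W x = c') : c = c' := by
  obtain ⟨ρ, hρ, h1⟩ := exists_eq_smul_unitVector hu
  obtain ⟨ρ', hρ', h2⟩ := exists_eq_smul_unitVector hv
  obtain ⟨k, hk⟩ := exists_int_clockwiseAngle u v
  have h3 : unitVector (planeAngle v) = unitVector (planeAngle u - clockwiseAngle u v) := by
    rw [← unitVector_add_int_mul (planeAngle v) k, ← sub_eq_of_eq_add hk]
    congr 1; linarith
  refine hW.eq_of_sector (clockwiseAngle_mem u v).1 hZ ?_ ?_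
  · rw [← sideFilter_smul _ _ _ hρ, smul_neg, ← leftNormal_smul, ← h1]
    exact hc
  · rw [← sideFilter_smul _ _ _ hρ', ← leftNormal_smul, ← h3, ← h2]
    exact hc'

/-- The left side of the arc is followed to its end, where it is the right side of the reversed arc.
Along a segment the value is constant; at a joint one sweeps clockwise from the segment just
traversed to the next, through a sector free of `Z`. In the induction `K` absorbs the segments
already traversed. -/
theorem IsPolygonalArc.exists_sideFilter {A : Set (ℝ × ℝ)} {p q : ℝ × ℝ}
    (hA : IsPolygonalArc A p q) {W : ℝ × ℝ → ZMod 2} {Z : Set (ℝ × ℝ)}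
    (hW : LocallyConstantOff W Z) {K : Set (ℝ × ℝ)} (hK : IsClosed K) (hZ : Z ⊆ K ∪ A)
    (hKA : K ∩ A ⊆ {p, q}) {u v : ℝ × ℝ} (hu : IsInitialDirection A p u)
    (hv : IsInitialDirection A q v)
    (hp : ∀ᶠ x in sideFilter p u (leftNormal u), x ∉ K)
    (hq : ∀ᶠ x in sideFilter q v (-leftNormal v), x ∉ K) :
    ∃ c, (∀ᶠ x in sideFilter p u (leftNormal u), W x = c) ∧
      (∀ᶠ x in sideFilter q v (-leftNormal v), W x = c) := by
  induction hA generalizing K u with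
  | single p q hpq =>
    obtain ⟨a, ha, rfl⟩ := (isInitialDirection_segment hpq).exists_eq_smul hu.1
      hu.eventually_mem.frequently
    obtain ⟨b, hb, rfl⟩ := (isInitialDirection_segment hpq.symm).exists_eq_smul hv.1
      (by rw [segment_symm]; exact hv.eventually_mem.frequently)
    have hn : -leftNormal (p - q) = leftNormal (q - p) := by rw [← leftNormal_neg, neg_sub]
    rw [leftNormal_smul, sideFilter_smul _ _ _ ha] at hp ⊢
    rw [leftNormal_smul, ← smul_neg, sideFilter_smul _ _ _ hb, hn] at hq ⊢
    refine hW.exists_sideFilter_segment hK hZ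
      (planeCross_leftNormal_ne_zero (sub_ne_zero.2 hpq.symm)) (fun x hx hxK => ?_) hp hq
    rcases hKA ⟨hxK, openSegment_subset_segment _ _ _ hx⟩ with rfl | rfl
    · exact hpq (left_mem_openSegment_iff.1 hx)
    · exact hpq (right_mem_openSegment_iff.1 hx)
  | cons p q' r A hpq hA hinter ih =>
    have hqr := hA.ne
    have hpA : p ∉ A := fun h => hpq (by
      have : p ∈ segment ℝ p q' ∩ A := ⟨left_mem_segment ℝ _ _, h⟩
      rwa [hinter] at this)
    have hrs : r ∉ segment ℝ p q' := fun h => hqr (by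
      have : r ∈ segment ℝ p q' ∩ A := ⟨h, hA.right_mem⟩
      rw [hinter] at this
      exact this.symm)
    have hAc := hA.isCompact.isClosed
    have hsc : IsClosed (segment ℝ p q') := (IsPolygonalArc.single p q' hpq).isCompact.isClosed
    have hpr : p ≠ r := fun h => hpA (h ▸ hA.right_mem)
    have hqK : q' ∉ K := fun h => by
      rcases hKA ⟨h, Or.inr hA.left_mem⟩ with h' | h'
      · exact hpq h'.symm
      · exact hqr h'
    have hvA : IsInitialDirection A r v := hv.congr (by
      filter_upwards [hsc.isOpen_compl.mem_nhds hrs] with x hx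
      simp [show x ∉ segment ℝ p q' from hx])
    obtain ⟨w, hw⟩ := hA.exists_isInitialDirection
    have hup : IsInitialDirection (segment ℝ p q') p u := hu.congr (by
      filter_upwards [hAc.isOpen_compl.mem_nhds hpA] with x hx
      simp [show x ∉ A from hx])
    obtain ⟨a, ha, rfl⟩ := (isInitialDirection_segment hpq).exists_eq_smul hu.1
      hup.eventually_mem.frequently
    have hn : -leftNormal (p - q') = leftNormal (q' - p) := by rw [← leftNormal_neg, neg_sub]
    have hcr := planeCross_leftNormal_ne_zero (sub_ne_zero.2 hpq.symm)
    have hcr' : planeCross (p - q') (leftNormal (q' - p)) ≠ 0 := by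
      rw [← hn]
      intro h
      apply planeCross_leftNormal_ne_zero (sub_ne_zero.2 hpq)
      simp only [planeCross, Prod.fst_neg, Prod.snd_neg] at h ⊢
      linarith
    rw [leftNormal_smul, sideFilter_smul _ _ _ ha] at hp ⊢
    obtain ⟨c, hc1, hc2⟩ := hW.exists_sideFilter_segment (K := K ∪ A) (p := p) (q := q')
      (n := leftNormal (q' - p)) (hK.union hAc)
      (hZ.trans (by rw [Set.union_assoc, Set.union_comm A])) hcr (fun x hx hxK => by
        have hxs := openSegment_subset_segment _ _ _ hx
        have hx1 : x ≠ p := by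
          rintro rfl; exact hpq (left_mem_openSegment_iff.1 hx)
        have hx2 : x ≠ q' := by
          rintro rfl; exact hpq (right_mem_openSegment_iff.1 hx)
        rcases hxK with h | h
        · rcases hKA ⟨h, Or.inl hxs⟩ with h' | h'
          · exact hx1 h'
          · exact hrs (h' ▸ hxs)
        · have : x ∈ segment ℝ p q' ∩ A := ⟨hxs, h⟩
          rw [hinter] at this
          exact hx2 this)
      (by
        filter_upwards [hp, eventually_sideFilter_of_notMem hAc hpA (q' - p) (leftNormal (q' - p))]
          with x h1 h2
        simp [h1, h2])
      (by
        filter_upwards [eventually_sideFilter_of_notMem hK hqK (p - q') (leftNormal (q' - p)),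
          hw.eventually_sideFilter hcr'] with x h1 h2
        simp [h1, h2])
    obtain ⟨c', hc1', hc2'⟩ := ih (K := K ∪ segment ℝ p q') (u := w) (hK.union hsc)
      (hZ.trans (by rw [Set.union_assoc])) (by
        rintro x ⟨hx1 | hx1, hx2⟩
        · rcases hKA ⟨hx1, Or.inr hx2⟩ with h' | h'
          · exact absurd (h' ▸ hx2) hpA
          · exact Or.inr h'
        · have : x ∈ segment ℝ p q' ∩ A := ⟨hx1, hx2⟩
          rw [hinter] at this
          exact Or.inl this) hw hvA
      (by
        have hs := isInitialDirection_segment hpq.symm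
        rw [segment_symm] at hs
        filter_upwards [eventually_sideFilter_of_notMem hK hqK w (leftNormal w),
          hs.eventually_sideFilter (planeCross_leftNormal_ne_zero hw.1)] with x h1 h2
        simp [h1, h2])
      (by
        filter_upwards [hq, eventually_sideFilter_of_notMem hsc hrs v (-leftNormal v)] with x h1 h2
        simp [h1, h2])
    have hcc : c = c' := by
      have hs := isInitialDirection_segment hpq.symm
      rw [segment_symm] at hs
      refine hW.eq_of_clockwise (b := q') (u := p - q') (v := w) hs.1 hw.1 ?_ (by rwa [hn]) hc1'
      -- A direction is at a full turn from itself, so the segment just traversed does not enter the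
      -- open sector.
      have hself : clockwiseAngle (p - q') (p - q') = 2 * Real.pi :=
        clockwiseAngle_eq ⟨Real.two_pi_pos, le_rfl⟩ (-1) (by push_cast; ring)
      filter_upwards [hw.eventually_sector (u := p - q') le_rfl,
        hs.eventually_sector (u := p - q') (hself ▸ (clockwiseAngle_mem (p - q') w).2),
        eventually_unitVector_of_nhds (hK.isOpen_compl.mem_nhds hqK)] with t h1 h2 h3 φ hφ hmem
      rcases hZ hmem with h | h | h
      · exact h3 φ h
      · exact h2 φ hφ h
      · exact h1 φ hφ h
    exact ⟨c, hc1, hcc ▸ hc2'⟩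

/-! ### The rotation system of a plane drawing -/

namespace SimpleGraph

variable {V : Type*} {G : SimpleGraph V}

namespace PlaneDrawing

/-- The arc that represents the edge underlying a dart. -/
def dartArc (D : G.PlaneDrawing) (d : G.Dart) : Set (ℝ × ℝ) := D.arc ⟨d.edge, d.edge_mem⟩

theorem dartArc_eq (D : G.PlaneDrawing) {d : G.Dart} {e : G.edgeSet} (h : d.edge = e) :
    D.dartArc d = D.arc e := by
  unfold dartArc; congr 1; exact Subtype.ext h

theorem dartArc_symm (D : G.PlaneDrawing) (d : G.Dart) : D.dartArc d.symm = D.dartArc d := by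
  exact D.dartArc_eq d.edge_symm

theorem isPolygonalArc_dartArc (D : G.PlaneDrawing) (d : G.Dart) :
    IsPolygonalArc (D.dartArc d) (D.point d.fst) (D.point d.snd) :=
  D.isPolygonalArc _ _ _ rfl

/-- The direction in which a dart leaves its first vertex. -/
noncomputable def direction (D : G.PlaneDrawing) (d : G.Dart) : ℝ × ℝ :=
  (D.isPolygonalArc_dartArc d).exists_isInitialDirection.choose

theorem isInitialDirection (D : G.PlaneDrawing) (d : G.Dart) :
    IsInitialDirection (D.dartArc d) (D.point d.fst) (D.direction d) :=
  (D.isPolygonalArc_dartArc d).exists_isInitialDirection.choose_spec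

theorem direction_ne_zero (D : G.PlaneDrawing) (d : G.Dart) : D.direction d ≠ 0 :=
  (D.isInitialDirection d).1

theorem exists_dart_of_mem_edge {e : G.edgeSet} {v : V} (h : v ∈ (e : Sym2 V)) :
    ∃ d : G.Dart, d.fst = v ∧ d.edge = e := by
  obtain ⟨w, hw⟩ := Sym2.mem_iff_exists.1 h
  have := e.2
  rw [hw] at this
  exact ⟨⟨(v, w), this⟩, rfl, hw.symm⟩

theorem dart_eq_of_fst_eq {d d' : G.Dart} (h : d.fst = d'.fst) (h' : d.edge = d'.edge) : d = d' := by
  rcases (dart_edge_eq_iff d d').1 h' with h1 | h1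
  · exact h1
  · rw [h1] at h
    exact absurd h.symm d'.adj.ne

/-- Arcs leaving a vertex in the same direction share points near it other than the vertex itself.
Such a point would be a second common end, which forces the edges to coincide. -/
theorem dart_eq_of_planeAngle (D : G.PlaneDrawing) {d d' : G.Dart} (h : d.fst = d'.fst) (k : ℤ)
    (hk : planeAngle (D.direction d) - planeAngle (D.direction d') = k * (2 * Real.pi)) :
    d = d' := by
  by_contra hne
  have he : d.edge ≠ d'.edge := fun he => hne (dart_eq_of_fst_eq h he)
  obtain ⟨a, ha, had⟩ := exists_pos_smul_of_planeAngle (D.direction_ne_zero d)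
    (D.direction_ne_zero d') k hk
  have h1 := (D.isInitialDirection d).eventually_mem
  have h2 := (tendsto_const_mul_nhdsGT_zero (inv_pos.2 ha)).eventually
    (D.isInitialDirection d').eventually_mem
  obtain ⟨t, ⟨h3, h4⟩, ht⟩ := ((h1.and h2).and self_mem_nhdsWithin).exists
  have ht : 0 < t := ht
  rw [had, smul_smul, mul_right_comm, inv_mul_cancel₀ ha.ne', one_mul, ← h] at h4
  obtain ⟨v, hv1, hv2, hv⟩ := D.eq_point_of_mem_of_mem ⟨d.edge, d.edge_mem⟩ ⟨d'.edge, d'.edge_mem⟩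
    (fun h => he (congrArg Subtype.val h)) _ h3 h4
  have hvd : d.fst ≠ v := by
    rintro rfl
    rw [add_eq_left] at hv
    exact smul_ne_zero ht.ne' (D.direction_ne_zero d) hv
  have hd : d.fst ∈ d.edge := by rw [Dart.edge, Sym2.mem_iff]; exact Or.inl rfl
  have hd' : d.fst ∈ d'.edge := by rw [h, Dart.edge, Sym2.mem_iff]; exact Or.inl rfl
  exact he (((Sym2.mem_and_mem_iff hvd).1 ⟨hd, hv1⟩).trans
    ((Sym2.mem_and_mem_iff hvd).1 ⟨hd', hv2⟩).symm)

/-- The clockwise angle from a dart to another one. -/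
noncomputable def dartAngle (D : G.PlaneDrawing) (d d' : G.Dart) : ℝ :=
  clockwiseAngle (D.direction d) (D.direction d')

theorem eq_of_dartAngle_eq (D : G.PlaneDrawing) {d d₁ d₂ : G.Dart} (h : d₁.fst = d₂.fst)
    (h' : D.dartAngle d d₁ = D.dartAngle d d₂) : d₁ = d₂ := by
  obtain ⟨k, hk⟩ := exists_int_clockwiseAngle (D.direction d) (D.direction d₁)
  obtain ⟨l, hl⟩ := exists_int_clockwiseAngle (D.direction d) (D.direction d₂)
  refine D.dart_eq_of_planeAngle h (l - k) ?_
  unfold dartAngle at h'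
  push_cast
  linear_combination hl - hk - h'

theorem eq_of_dartAngle_eq' (D : G.PlaneDrawing) {d d₁ d₂ : G.Dart} (h : d₁.fst = d₂.fst)
    (h' : D.dartAngle d₁ d = D.dartAngle d₂ d) : d₁ = d₂ := by
  obtain ⟨k, hk⟩ := exists_int_clockwiseAngle (D.direction d₁) (D.direction d)
  obtain ⟨l, hl⟩ := exists_int_clockwiseAngle (D.direction d₂) (D.direction d)
  refine D.dart_eq_of_planeAngle h (k - l) ?_
  unfold dartAngle at h'
  push_cast
  linear_combination hk - hl + h'

/-- The clockwise rotation around the vertices of a plane drawing: `σ d` follows `d` in the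
clockwise order of the darts at the first vertex of `d`. -/
structure IsRotation (D : G.PlaneDrawing) (σ : G.Dart → G.Dart) : Prop where
  fst_eq : ∀ d, (σ d).fst = d.fst
  dartAngle_le : ∀ d d', d'.fst = d.fst → D.dartAngle d (σ d) ≤ D.dartAngle d d'

theorem exists_isRotation [Finite V] (D : G.PlaneDrawing) : ∃ σ, D.IsRotation σ := by
  have h (d : G.Dart) : ∃ e : G.Dart, e.fst = d.fst ∧
      ∀ d' : G.Dart, d'.fst = d.fst → D.dartAngle d e ≤ D.dartAngle d d' := by
    have : Finite G.Dart := Finite.of_injective _ Dart.toProd_injective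
    obtain ⟨e, he, hmin⟩ := Set.exists_min_image {d' : G.Dart | d'.fst = d.fst} (D.dartAngle d)
      (Set.toFinite _) ⟨d, rfl⟩
    exact ⟨e, he, hmin⟩
  choose σ h1 h2 using h
  exact ⟨σ, h1, h2⟩

/-- If two darts had the same successor at different angles, the one nearer to it would lie strictly
between the other and its successor, against minimality. -/
theorem IsRotation.injective {D : G.PlaneDrawing} {σ : G.Dart → G.Dart} (hσ : D.IsRotation σ) :
    Function.Injective σ := by
  have key (d₁ d₂ : G.Dart) (h : σ d₁ = σ d₂) :
      ¬ D.dartAngle d₁ (σ d₁) < D.dartAngle d₂ (σ d₂) := by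
    intro hlt
    have hf : d₁.fst = d₂.fst := by rw [← hσ.fst_eq d₁, h, hσ.fst_eq]
    obtain ⟨k, hk⟩ := exists_int_clockwiseAngle (D.direction d₁) (D.direction (σ d₁))
    obtain ⟨l, hl⟩ := exists_int_clockwiseAngle (D.direction d₂) (D.direction (σ d₂))
    have h1 := clockwiseAngle_mem (D.direction d₁) (D.direction (σ d₁))
    have h2 := clockwiseAngle_mem (D.direction d₂) (D.direction (σ d₂))
    have h3 := hσ.dartAngle_le d₂ d₁ hf
    unfold dartAngle at h3 hlt
    have h4 : clockwiseAngle (D.direction d₂) (D.direction d₁) =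
        clockwiseAngle (D.direction d₂) (D.direction (σ d₂)) -
        clockwiseAngle (D.direction d₁) (D.direction (σ d₁)) :=
      clockwiseAngle_eq ⟨by linarith, by linarith [h1.1, h2.2]⟩ (l - k) (by
        rw [h] at hk ⊢; push_cast; linear_combination hl - hk)
    linarith [h1.1]
  intro d₁ d₂ h
  refine D.eq_of_dartAngle_eq' (d := σ d₁) (by rw [← hσ.fst_eq d₁, h, hσ.fst_eq]) ?_
  have := key d₁ d₂ h
  have := key d₂ d₁ h.symm
  rw [← h] at *
  linarith

/-- The angles from `d` to `σ d` and back sum to at least a full turn, while a further dart would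
have to lie beyond `σ d` as seen from `d` and beyond `d` as seen from `σ d`. This detects vertices
of degree at most 2. -/
theorem IsRotation.eq_or_eq {D : G.PlaneDrawing} {σ : G.Dart → G.Dart} (hσ : D.IsRotation σ)
    {d : G.Dart} (hd : σ (σ d) = d) {d' : G.Dart} (hd' : d'.fst = d.fst) : d' = d ∨ d' = σ d := by
  have hle := hσ.dartAngle_le d d' hd'
  have hle' := hσ.dartAngle_le (σ d) d' (hd'.trans (hσ.fst_eq d).symm)
  rw [hd] at hle'
  obtain ⟨k, hk⟩ := exists_int_clockwiseAngle (D.direction d) (D.direction (σ d))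
  obtain ⟨l, hl⟩ := exists_int_clockwiseAngle (D.direction (σ d)) (D.direction d)
  obtain ⟨m, hm⟩ := exists_int_clockwiseAngle (D.direction (σ d)) (D.direction d')
  have h1 := clockwiseAngle_mem (D.direction d) (D.direction (σ d))
  have h2 := clockwiseAngle_mem (D.direction (σ d)) (D.direction d)
  have h3 := clockwiseAngle_mem (D.direction (σ d)) (D.direction d')
  have hpi := Real.two_pi_pos
  unfold dartAngle at *
  set a := clockwiseAngle (D.direction d) (D.direction (σ d))
  set b := clockwiseAngle (D.direction (σ d)) (D.direction d)
  set y := clockwiseAngle (D.direction (σ d)) (D.direction d') with hy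
  have hab : a + b = (-(k + l) : ℤ) * (2 * Real.pi) := by push_cast; linear_combination -hk - hl
  have hge : 2 * Real.pi ≤ a + b := by
    have : 0 < -(k + l) := by
      have : (0 : ℝ) < (-(k + l) : ℤ) := by
        by_contra! h
        nlinarith [h1.1, h2.1]
      exact_mod_cast this
    have : (1 : ℝ) ≤ (-(k + l) : ℤ) := by exact_mod_cast this
    nlinarith
  rcases (show 2 * Real.pi ≤ a + y by linarith).eq_or_lt with h | h
  · left
    exact D.eq_of_dartAngle_eq (d := σ d) hd' (by unfold dartAngle; linarith)
  · right
    refine D.eq_of_dartAngle_eq (d := d) (hd'.trans (hσ.fst_eq d).symm) ?_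
    have h4 : clockwiseAngle (D.direction d) (D.direction d') = a + y - 2 * Real.pi :=
      clockwiseAngle_eq ⟨by linarith, by linarith [h1.2, h3.2]⟩ (k + m + 1) (by
        push_cast; linear_combination hk + hm)
    unfold dartAngle
    linarith [h3.2]

/-- The union of the arcs of a drawing. -/
def support (D : G.PlaneDrawing) : Set (ℝ × ℝ) := ⋃ e, D.arc e

theorem isClosed_arc (D : G.PlaneDrawing) (e : G.edgeSet) : IsClosed (D.arc e) := by
  obtain ⟨e, he⟩ := e
  induction e with | _ v w => exact (D.isPolygonalArc _ v w rfl).isCompact.isClosed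

theorem exists_sideFilter [Finite V] (D : G.PlaneDrawing) {W : ℝ × ℝ → ZMod 2}
    (hW : LocallyConstantOff W D.support) (d : G.Dart) :
    ∃ c, (∀ᶠ x in sideFilter (D.point d.fst) (D.direction d) (leftNormal (D.direction d)), W x = c) ∧
      (∀ᶠ x in sideFilter (D.point d.snd) (D.direction d.symm) (-leftNormal (D.direction d.symm)),
        W x = c) := by
  have : Finite G.edgeSet := inferInstance
  have key (d' : G.Dart) (n : ℝ × ℝ) (hn : planeCross (D.direction d') n ≠ 0) :
      ∀ᶠ x in sideFilter (D.point d'.fst) (D.direction d') n,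
        x ∉ ⋃ e : {e : G.edgeSet // (e : Sym2 V) ≠ d.edge}, D.arc e := by
    have : ∀ e : {e : G.edgeSet // (e : Sym2 V) ≠ d.edge},
        ∀ᶠ x in sideFilter (D.point d'.fst) (D.direction d') n, x ∉ D.arc e := by
      intro e
      by_cases h : D.point d'.fst ∈ D.arc e
      · obtain ⟨d₁, h1, h2⟩ := exists_dart_of_mem_edge (D.mem_of_point_mem _ _ h)
        have := (D.isInitialDirection d₁).eventually_sideFilter hn
        rw [h1] at this
        filter_upwards [this] with x hx
        rwa [D.dartArc_eq h2] at hx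
      · exact eventually_sideFilter_of_notMem (D.isClosed_arc _) h _ _
    filter_upwards [Filter.eventually_all.2 this] with x hx
    rw [Set.mem_iUnion]
    rintro ⟨e, he⟩
    exact hx e he
  refine (D.isPolygonalArc_dartArc d).exists_sideFilter hW
    (K := ⋃ e : {e : G.edgeSet // (e : Sym2 V) ≠ d.edge}, D.arc e)
    (isClosed_iUnion_of_finite fun e => D.isClosed_arc _) ?_ ?_ (D.isInitialDirection d) ?_ ?_ ?_
  · intro x hx
    obtain ⟨e, he⟩ := Set.mem_iUnion.1 hx
    by_cases h : (e : Sym2 V) = d.edge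
    · right
      rwa [D.dartArc_eq h.symm]
    · exact Or.inl (Set.mem_iUnion.2 ⟨⟨e, h⟩, he⟩)
  · rintro x ⟨hx1, hx2⟩
    obtain ⟨e, he⟩ := Set.mem_iUnion.1 hx1
    obtain ⟨v, hv1, hv2, rfl⟩ := D.eq_point_of_mem_of_mem e.1 ⟨d.edge, d.edge_mem⟩
      (fun h => e.2 (congrArg Subtype.val h)) x he hx2
    rcases Sym2.mem_iff.1 hv2 with rfl | rfl
    · exact Or.inl rfl
    · exact Or.inr rfl
  · rw [← D.dartArc_symm]
    exact D.isInitialDirection d.symm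
  · exact key d _ (planeCross_leftNormal_ne_zero (D.direction_ne_zero d))
  · refine key d.symm _ ?_
    intro h
    apply planeCross_leftNormal_ne_zero (D.direction_ne_zero d.symm)
    simp only [planeCross, Prod.fst_neg, Prod.snd_neg] at h ⊢
    linarith

/-- By minimality of the angle, no arc enters the sector swept clockwise from `d` to `σ d`. -/
theorem IsRotation.sideFilter_eq [Finite V] {D : G.PlaneDrawing} {σ : G.Dart → G.Dart} (hσ : D.IsRotation σ)
    {W : ℝ × ℝ → ZMod 2} (hW : LocallyConstantOff W D.support) {d : G.Dart} {c c' : ZMod 2}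
    (hc : ∀ᶠ x in sideFilter (D.point d.fst) (D.direction d) (-leftNormal (D.direction d)), W x = c)
    (hc' : ∀ᶠ x in sideFilter (D.point d.fst) (D.direction (σ d))
      (leftNormal (D.direction (σ d))), W x = c') : c = c' := by
  refine hW.eq_of_clockwise (D.direction_ne_zero d) (D.direction_ne_zero (σ d)) ?_ hc hc'
  have : ∀ e : G.edgeSet, ∀ᶠ t : ℝ in 𝓝[>] 0, ∀ φ ∈ Set.Ioo
      (planeAngle (D.direction d) - clockwiseAngle (D.direction d) (D.direction (σ d)))
      (planeAngle (D.direction d)), D.point d.fst + t • unitVector φ ∉ D.arc e := by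
    intro e
    by_cases h : D.point d.fst ∈ D.arc e
    · obtain ⟨d₁, h1, h2⟩ := exists_dart_of_mem_edge (D.mem_of_point_mem _ _ h)
      have := (D.isInitialDirection d₁).eventually_sector (u := D.direction d)
        (hσ.dartAngle_le d d₁ h1)
      rw [h1] at this
      filter_upwards [this] with t ht φ hφ
      rw [← D.dartArc_eq h2]
      exact ht φ hφ
    · filter_upwards [eventually_unitVector_of_nhds ((D.isClosed_arc e).isOpen_compl.mem_nhds h)]
        with t ht φ _
      exact ht φ
  filter_upwards [Filter.eventually_all.2 this] with t ht φ hφ hmem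
  obtain ⟨e, he⟩ := Set.mem_iUnion.1 hmem
  exact ht e φ hφ he

end PlaneDrawing

end SimpleGraph

/-! ### Even edge weights as coboundaries on faces -/

namespace SimpleGraph

variable {V : Type*} {G : SimpleGraph V}

/-- An edge weight modulo 2 is even if the weights at each vertex sum to zero. -/
def IsEvenWeight [Fintype G.edgeSet] [DecidableEq V] (z : G.edgeSet → ZMod 2) : Prop :=
  ∀ v, (∑ e : G.edgeSet, if v ∈ (e : Sym2 V) then z e else 0) = 0

theorem IsEvenWeight.sum_eq_zero [Fintype V] [Fintype G.edgeSet] [DecidableEq V]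
    {z : G.edgeSet → ZMod 2}
    (hz : IsEvenWeight z) (δ : G.edgeSet → G.Dart) (hδ : ∀ e, (δ e).edge = e) (g : V → ZMod 2) :
    ∑ e, z e * (g (δ e).fst + g (δ e).snd) = 0 := by
  have h (e : G.edgeSet) : z e * (g (δ e).fst + g (δ e).snd) =
      ∑ v, g v * (if v ∈ (e : Sym2 V) then z e else 0) := by
    have : ∀ v, v ∈ (e : Sym2 V) ↔ v = (δ e).fst ∨ v = (δ e).snd := by
      intro v; rw [← hδ e, Dart.edge, Sym2.mem_iff]
    simp only [this, mul_ite, mul_zero]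
    rw [← Finset.sum_filter, Finset.filter_or, Finset.sum_union]
    · simp [Finset.filter_eq', mul_add, mul_comm]
    · rw [Finset.disjoint_filter]
      rintro v - rfl
      exact (δ e).adj.ne
  simp only [h]
  rw [Finset.sum_comm]
  simp only [← Finset.mul_sum]
  exact Finset.sum_eq_zero fun v _ => by rw [hz v, mul_zero]

namespace PlaneDrawing

/-- Take the sum of the parity functions of the arcs, weighted by `z`. The ray jumps collect at the
vertices, where evenness of `z` cancels them, and only the jump across each arc survives. -/
theorem exists_parity [Fintype V] [Fintype G.edgeSet] [DecidableEq V] (D : G.PlaneDrawing)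
    (δ : G.edgeSet → G.Dart) (hδ : ∀ e, (δ e).edge = e)
    {z : G.edgeSet → ZMod 2} (hz : IsEvenWeight z) :
    ∃ W, LocallyConstantOff W D.support ∧ ∀ (e : G.edgeSet) (c c' : ZMod 2),
      (∀ᶠ x in sideFilter (D.point (δ e).fst) (D.direction (δ e)) (leftNormal (D.direction (δ e))),
        W x = c) →
      (∀ᶠ x in sideFilter (D.point (δ e).fst) (D.direction (δ e)) (-leftNormal (D.direction (δ e))),
        W x = c') →
      c + c' = z e := by
  have harc (e : G.edgeSet) : IsPolygonalArc (D.arc e) (D.point (δ e).fst) (D.point (δ e).snd) := by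
    rw [← D.dartArc_eq (hδ e)]; exact D.isPolygonalArc_dartArc _
  choose f hf q' hq' hseg hjump using fun e => (harc e).exists_parity
  have hsum (x₀ x : ℝ × ℝ) : ∑ e, z e * (rayJump (D.point (δ e).fst) x₀ x +
      rayJump (D.point (δ e).snd) x₀ x) = 0 :=
    hz.sum_eq_zero δ hδ fun v => rayJump (D.point v) x₀ x
  refine ⟨fun x => ∑ e, z e * f e x, fun x₀ hx₀ => ?_, fun e₀ c c' hc hc' => ?_⟩
  · have : ∀ e, ∀ᶠ x in 𝓝 x₀, f e x = f e x₀ + rayJump (D.point (δ e).fst) x₀ x +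
        rayJump (D.point (δ e).snd) x₀ x := fun e =>
      hf e x₀ fun h => hx₀ (Set.mem_iUnion.2 ⟨e, h⟩)
    filter_upwards [Filter.eventually_all.2 this] with x hx
    simp only [hx, add_assoc]
    simp only [mul_add (z _) (f _ _)]
    rw [Finset.sum_add_distrib, hsum, add_zero]
  · set p := D.point (δ e₀).fst with hp
    set u := q' e₀ - p with hu
    have hdir : IsInitialDirection (D.arc e₀) p (D.direction (δ e₀)) := by
      rw [← D.dartArc_eq (hδ e₀)]; exact D.isInitialDirection _
    have hmem : ∀ t : ℝ, 0 < t → t < 1 → p + t • u ∈ D.arc e₀ := fun t h0 h1 =>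
      hseg e₀ (openSegment_subset_segment _ _ _ (mem_openSegment_of_lt_one h0 h1))
    have h01 : ∀ᶠ t : ℝ in 𝓝[>] 0, 0 < t ∧ t < 1 := Ioo_mem_nhdsGT one_pos
    have hu0 : u ≠ 0 := sub_ne_zero.2 (hq' e₀).symm
    obtain ⟨a, ha, hau⟩ := hdir.exists_eq_smul hu0
      (Filter.Eventually.frequently (by filter_upwards [h01] with t ht using hmem t ht.1 ht.2))
    rw [← sideFilter_smul _ _ _ ha, ← leftNormal_smul, ← hau] at hc
    rw [← sideFilter_smul _ _ _ ha, smul_neg, ← leftNormal_smul, ← hau] at hc'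
    -- Passing to iterated limits allows a point `m` of the arc to be fixed first; the arc is then
    -- crossed at `m` alone, where no other arc passes.
    have h1 := (Filter.eventually_map.1 hc).curry
    have h2 := (Filter.eventually_map.1 hc').curry
    have h3 := (tendsto_add_smul_nhds_zero p u).eventually_ne (harc e₀).ne
    obtain ⟨t, h1, h2, h3, ht0, ht1⟩ := (h1.and (h2.and (h3.and h01))).exists
    set m := p + t • u with hm
    have hme : ∀ e, e ≠ e₀ → m ∉ D.arc e := by
      intro e he hme
      obtain ⟨v, -, hv, hmv⟩ := D.eq_point_of_mem_of_mem e e₀ he m hme (hmem t ht0 ht1)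
      rw [← hδ e₀] at hv
      rcases Sym2.mem_iff.1 hv with rfl | rfl
      · rw [hm, ← hp, add_eq_left] at hmv
        exact smul_ne_zero ht0.ne' hu0 hmv
      · exact h3 hmv
    obtain ⟨k, hk⟩ := hjump e₀ t ht0 ht1
    have hcont : Continuous fun r : ℝ => m + r • leftNormal u := by fun_prop
    have hlim := hcont.tendsto' 0 m (by simp)
    have hall : ∀ᶠ r : ℝ in 𝓝 0, r ≠ 0 → ∑ e, z e * f e (m + r • leftNormal u) =
        (∑ e, z e * (if e = e₀ then k else f e m)) + z e₀ * (if 0 < r then 1 else 0) := by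
      have : ∀ e, ∀ᶠ r : ℝ in 𝓝 0, r ≠ 0 → f e (m + r • leftNormal u) =
          (if e = e₀ then k else f e m) + (if e = e₀ then (if 0 < r then 1 else 0) else 0) +
          (rayJump (D.point (δ e).fst) m (m + r • leftNormal u) +
            rayJump (D.point (δ e).snd) m (m + r • leftNormal u)) := by
        intro e
        by_cases he : e = e₀
        · subst he
          filter_upwards [hk] with r hr hr0
          rw [hr hr0, if_pos rfl, if_pos rfl, add_assoc]
        · filter_upwards [hlim.eventually (hf e m (hme e he))] with r hr _
          rw [hr, if_neg he, if_neg he, add_zero, add_assoc]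
      filter_upwards [Filter.eventually_all.2 this] with r hr hr0
      simp only [fun e => hr e hr0]
      have h0 := hsum m (m + r • leftNormal u)
      simp only [mul_add, Finset.sum_add_distrib] at h0 ⊢
      rw [h0, add_zero]
      simp
    have hpos : Tendsto (fun s : ℝ => t * s) (𝓝[>] 0) (𝓝 0) :=
      (tendsto_const_mul_nhdsGT_zero ht0).mono_right nhdsWithin_le_nhds
    have hneg : Tendsto (fun s : ℝ => -(t * s)) (𝓝[>] 0) (𝓝 0) := by simpa using hpos.neg
    obtain ⟨s, ⟨⟨h1, h2⟩, h4, h5⟩, hs⟩ := (((h1.and h2).and ((hpos.eventually hall).and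
      (hneg.eventually hall))).and self_mem_nhdsWithin).exists
    have hts : 0 < t * s := mul_pos ht0 hs
    have h4 := h4 hts.ne'
    have h5 := h5 (neg_ne_zero.2 hts.ne')
    have e1 : p + t • (u + s • leftNormal u) = m + (t * s) • leftNormal u := by
      rw [hm]; module
    have e2 : p + t • (u + s • -leftNormal u) = m + (-(t * s)) • leftNormal u := by
      rw [hm]; module
    rw [← h1, ← h2]
    simp only
    rw [e1, e2, h4, h5, if_pos hts, if_neg (by linarith), mul_zero, add_zero, mul_one]
    linear_combination ZMod.add_self_two (∑ e, z e * (if e = e₀ then k else f e m))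

/-- The permutation of the darts whose orbits are the boundary walks of the faces. -/
theorem exists_faceMap [Fintype V] [Fintype G.edgeSet] [DecidableEq V] (D : G.PlaneDrawing) :
    ∃ φ : Equiv.Perm G.Dart, (∀ d, (φ d).fst = d.snd) ∧
      (∀ d, φ (φ d).symm = d.symm → ∀ d' : G.Dart, d'.fst = d.snd → d' = d.symm ∨ d' = φ d) ∧
      ∀ z : G.edgeSet → ZMod 2, IsEvenWeight z → ∃ w : G.Dart → ZMod 2,
        (∀ d, w (φ d) = w d) ∧ ∀ d, w d + w d.symm = z ⟨d.edge, d.edge_mem⟩ := by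
  obtain ⟨σ, hσ⟩ := D.exists_isRotation
  have hinj : Function.Injective fun d : G.Dart => σ d.symm :=
    hσ.injective.comp Dart.symm_involutive.injective
  have : Finite G.Dart := Finite.of_injective _ Dart.toProd_injective
  refine ⟨Equiv.ofBijective _ (Finite.injective_iff_bijective.1 hinj), fun d => ?_, fun d hd d' hd' => ?_,
    fun z hz => ?_⟩
  · exact hσ.fst_eq d.symm
  · simp only [Equiv.ofBijective_apply, Dart.symm_symm] at hd ⊢
    exact hσ.eq_or_eq hd hd'
  · have hex (e : G.edgeSet) : ∃ d : G.Dart, d.edge = e := by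
      obtain ⟨e, he⟩ := e
      induction e with | _ v w => exact ⟨⟨(v, w), he⟩, rfl⟩
    choose δ hδ using hex
    obtain ⟨W, hW, hjump⟩ := D.exists_parity δ hδ hz
    choose w hw1 hw2 using D.exists_sideFilter hW
    refine ⟨w, fun d => ?_, fun d => ?_⟩
    -- The value on the left of `d` arrives at `d.snd` as the value on the right of `d.symm`; a
    -- clockwise sweep carries it to the left of `σ d.symm`, the next dart of the face.
    · have h := hw1 (σ d.symm)
      rw [hσ.fst_eq] at h
      exact (hσ.sideFilter_eq (d := d.symm) hW (hw2 d) h).symm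
    · have key : ∀ e, w (δ e) + w (δ e).symm = z e := fun e =>
        hjump e _ _ (hw1 (δ e)) (hw2 (δ e).symm)
      have h := key ⟨d.edge, d.edge_mem⟩
      rcases (dart_edge_eq_iff _ _).1 (hδ ⟨d.edge, d.edge_mem⟩) with h' | h'
      · rwa [h'] at h
      · rwa [h', Dart.symm_symm, add_comm] at h

end PlaneDrawing

end SimpleGraph

/-! ### Euler's inequality and the charge of triangular faces -/

open Finset

namespace SimpleGraph

variable {V : Type*} {G : SimpleGraph V}

/-- The lower bound for the number of faces in Euler's formula: even edge weights are coboundaries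
of functions on the faces. -/
theorem card_edges_add_one_le [Fintype V] [DecidableEq V] [DecidableRel G.Adj] [Nonempty G.Dart]
    (φ : Equiv.Perm G.Dart) [Fintype (Quotient (Equiv.Perm.SameCycle.setoid φ))]
    (hφ : ∀ z : G.edgeSet → ZMod 2, IsEvenWeight z → ∃ w : G.Dart → ZMod 2,
        (∀ d, w (φ d) = w d) ∧ ∀ d, w d + w d.symm = z ⟨d.edge, d.edge_mem⟩) :
    #G.edgeFinset + 1 ≤
      #{v : V | 0 < G.degree v} + Fintype.card (Quotient (Equiv.Perm.SameCycle.setoid φ)) := by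
  let Q := Quotient (Equiv.Perm.SameCycle.setoid φ)
  let mk : G.Dart → Q := Quotient.mk _
  have hex (e : G.edgeSet) : ∃ d : G.Dart, d.edge = e := by
    obtain ⟨e, he⟩ := e
    induction e with | _ v w => exact ⟨⟨(v, w), he⟩, rfl⟩
  choose δ hδ using hex
  let bd : (G.edgeSet → ZMod 2) →ₗ[ZMod 2] ({v : V // 0 < G.degree v} → ZMod 2) :=
    LinearMap.pi fun v => ∑ e : G.edgeSet, if (v : V) ∈ (e : Sym2 V) then LinearMap.proj e else 0
  let cobd : (Q → ZMod 2) →ₗ[ZMod 2] (G.edgeSet → ZMod 2) :=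
    LinearMap.pi fun e => (LinearMap.proj (mk (δ e)) : (Q → ZMod 2) →ₗ[ZMod 2] ZMod 2) +
      LinearMap.proj (mk (δ e).symm)
  have hle : LinearMap.ker bd ≤ LinearMap.range cobd := by
    intro z hz
    have heven : IsEvenWeight z := by
      intro v
      by_cases hv : 0 < G.degree v
      · have := congrFun (LinearMap.mem_ker.1 hz) ⟨v, hv⟩
        simp only [bd, LinearMap.pi_apply, LinearMap.sum_apply] at this
        refine Eq.trans (Finset.sum_congr rfl fun e _ => ?_) this
        split_ifs <;> simp
      · refine Finset.sum_eq_zero fun e _ => if_neg fun hve => hv ?_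
        obtain ⟨w, hw⟩ := Sym2.mem_iff_exists.1 hve
        have := e.2
        rw [hw] at this
        exact (G.degree_pos_iff_exists_adj v).2 ⟨w, this⟩
    obtain ⟨w, hw1, hw2⟩ := hφ z heven
    have hw3 (n : ℕ) (d : G.Dart) : w ((φ ^ n) d) = w d := by
      induction n with
      | zero => rfl
      | succ n ih => rw [pow_succ', Equiv.Perm.mul_apply, hw1, ih]
    refine ⟨fun q => Quotient.liftOn q w fun d d' hdd' => ?_, funext fun e => ?_⟩
    · have h : φ.SameCycle d d' := hdd'
      obtain ⟨n, -, hn⟩ := h.exists_pow_eq'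
      rw [← hn, hw3]
    · have := hw2 (δ e)
      simp only [cobd, LinearMap.pi_apply, LinearMap.add_apply, LinearMap.proj_apply]
      refine this.trans ?_
      congr 1
      exact Subtype.ext (hδ e)
  have h1 := LinearMap.finrank_range_add_finrank_ker bd
  have h2 := LinearMap.finrank_range_add_finrank_ker cobd
  have h3 := Submodule.finrank_mono hle
  -- Bounding this rank by the full number of non-isolated vertices loses 1 against Euler's formula,
  -- which still leaves the total charge negative.
  have h4 := (LinearMap.range bd).finrank_le
  have h5 : 0 < Module.finrank (ZMod 2) (LinearMap.ker cobd) := by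
    rw [Module.finrank_pos_iff_exists_ne_zero]
    refine ⟨⟨fun _ => 1, ?_⟩, fun h => ?_⟩
    · rw [LinearMap.mem_ker]
      funext e
      simp [cobd, CharTwo.add_self_eq_zero]
    · have := congrFun (congrArg Subtype.val h) (mk (Classical.arbitrary _))
      simp at this
  rw [Module.finrank_fintype_fun_eq_card] at h1 h2 h4
  rw [Fintype.card_subtype] at h4
  rw [G.edgeFinset_card]
  change _ ≤ _ + Fintype.card Q
  omega

section FaceMap

variable {φ : Equiv.Perm G.Dart}

theorem faceMap_apply_ne (hfst : ∀ d, (φ d).fst = d.snd) (d : G.Dart) : φ d ≠ d := fun h =>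
  d.adj.ne ((congrArg (fun d : G.Dart => d.fst) h).symm.trans (hfst d))

theorem Dart.ext' {d d' : G.Dart} (h1 : d.fst = d'.fst) (h2 : d.snd = d'.snd) : d = d' :=
  Dart.ext _ _ (Prod.ext h1 h2)

theorem degree_le_of_faceMap [Fintype V] [DecidableEq V] [DecidableRel G.Adj]
    (hrot : ∀ d, φ (φ d).symm = d.symm → ∀ d' : G.Dart, d'.fst = d.snd → d' = d.symm ∨ d' = φ d)
    {d : G.Dart} (hd : φ (φ d).symm = d.symm) : G.degree d.snd ≤ #{d.symm, φ d} := by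
  rw [← G.dart_fst_fiber_card_eq_degree d.snd]
  refine Finset.card_le_card fun d' hd' => ?_
  have := hrot d hd d' (by simpa using hd')
  simpa using this

/-- A face of length 2 would run along one edge and back, so that `d.snd` would have degree 1. -/
theorem faceMap_faceMap_apply_ne [Fintype V] [DecidableEq V] [DecidableRel G.Adj]
    (hfst : ∀ d, (φ d).fst = d.snd)
    (hrot : ∀ d, φ (φ d).symm = d.symm → ∀ d' : G.Dart, d'.fst = d.snd → d' = d.symm ∨ d' = φ d)
    (hdeg : ∀ d : G.Dart, 2 ≤ G.degree d.fst) (d : G.Dart) : φ (φ d) ≠ d := by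
  intro h
  have h1 : φ d = d.symm := Dart.ext' (hfst d) (by
    rw [← hfst (φ d), h]; rfl)
  have h2 := degree_le_of_faceMap hrot (d := d) (by rw [h1, Dart.symm_symm, h1])
  have h3 := hdeg d.symm
  rw [h1] at h2
  simp at h2
  change 2 ≤ G.degree d.snd at h3
  omega

/-- Each dart contributes 3, and 1 more if its face is a triangle. A triangle then collects `9 + 3`
and any longer face at least `3 * 4`. -/
theorem card_quotient_faceMap_le [Fintype V] [DecidableEq V] [DecidableRel G.Adj]
    [Fintype (Quotient (Equiv.Perm.SameCycle.setoid φ))]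
    (hfst : ∀ d, (φ d).fst = d.snd)
    (hrot : ∀ d, φ (φ d).symm = d.symm → ∀ d' : G.Dart, d'.fst = d.snd → d' = d.symm ∨ d' = φ d)
    (hdeg : ∀ d : G.Dart, 2 ≤ G.degree d.fst) :
    12 * Fintype.card (Quotient (Equiv.Perm.SameCycle.setoid φ)) ≤
      3 * Fintype.card G.Dart + #{d : G.Dart | φ (φ (φ d)) = d} := by
  classical
  let Q := Quotient (Equiv.Perm.SameCycle.setoid φ)
  let mk : G.Dart → Q := Quotient.mk _
  have hmk (d) : mk (φ d) = mk d := Quotient.sound (Equiv.Perm.sameCycle_apply_left.2 (Equiv.Perm.SameCycle.refl _ _))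
  have h1 : Fintype.card G.Dart = ∑ q : Q, #{d : G.Dart | mk d = q} :=
    Finset.card_eq_sum_card_fiberwise (s := univ) (t := univ) fun _ _ => mem_coe.2 (mem_univ _)
  have h2 : #{d : G.Dart | φ (φ (φ d)) = d} =
      ∑ q : Q, #{d ∈ ({d : G.Dart | φ (φ (φ d)) = d} : Finset G.Dart) | mk d = q} :=
    Finset.card_eq_sum_card_fiberwise (t := univ) fun _ _ => mem_coe.2 (mem_univ _)
  have h3 : 12 * Fintype.card Q = ∑ q : Q, 12 := by simp [mul_comm]
  change 12 * Fintype.card Q ≤ _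
  rw [h1, h2, h3, Finset.mul_sum, ← Finset.sum_add_distrib]
  refine Finset.sum_le_sum fun q _ => ?_
  obtain ⟨d, rfl⟩ := Quotient.exists_rep q
  change 12 ≤ 3 * #{d' : G.Dart | mk d' = mk d} +
    #{d' ∈ ({d : G.Dart | φ (φ (φ d)) = d} : Finset G.Dart) | mk d' = mk d}
  have n1 := faceMap_apply_ne hfst
  have n2 := faceMap_faceMap_apply_ne hfst hrot hdeg
  by_cases h : φ (φ (φ d)) = d
  · have c3 : #{d, φ d, φ (φ d)} = 3 :=
      Finset.card_eq_three.2 ⟨_, _, _, (n1 d).symm, (n2 d).symm, (n1 _).symm, rfl⟩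
    have s1 : ({d, φ d, φ (φ d)} : Finset G.Dart) ⊆
        {d' ∈ ({d : G.Dart | φ (φ (φ d)) = d} : Finset G.Dart) | mk d' = mk d} := by
      intro x hx
      simp only [mem_insert, mem_singleton] at hx
      rcases hx with rfl | rfl | rfl <;> simp [hmk, h]
    have s2 : ({d' ∈ ({d : G.Dart | φ (φ (φ d)) = d} : Finset G.Dart) | mk d' = mk d}) ⊆
        ({d' : G.Dart | mk d' = mk d} : Finset G.Dart) := by
      intro x hx
      simp only [mem_filter] at hx ⊢
      exact ⟨mem_univ _, hx.2⟩
    have := Finset.card_le_card s1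
    have := Finset.card_le_card s2
    omega
  · have c4 : #{d, φ d, φ (φ d), φ (φ (φ d))} = 4 := by
      rw [Finset.card_insert_of_notMem, Finset.card_eq_three.2
        ⟨_, _, _, (n1 (φ d)).symm, (n2 (φ d)).symm, (n1 _).symm, rfl⟩]
      simp only [mem_insert, mem_singleton, not_or]
      exact ⟨(n1 d).symm, (n2 d).symm, Ne.symm h⟩
    have s1 : ({d, φ d, φ (φ d), φ (φ (φ d))} : Finset G.Dart) ⊆
        ({d' : G.Dart | mk d' = mk d} : Finset G.Dart) := by
      intro x hx
      simp only [mem_insert, mem_singleton] at hx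
      rcases hx with rfl | rfl | rfl | rfl <;> simp [hmk]
    have := Finset.card_le_card s1
    omega

/-- Map a triangular dart at `v` to the other edge at `v` of its triangle, directed away from `v`.
Its image is not triangular: two triangles on that edge with different third vertices form a kite,
and with the same third vertex they would give two adjacent vertices of degree at most 2. -/
theorem two_mul_card_triangle_darts_le [Fintype V] [DecidableEq V] [DecidableRel G.Adj]
    (hkite : ¬ G.HasKite) (hfst : ∀ d, (φ d).fst = d.snd)
    (hrot : ∀ d, φ (φ d).symm = d.symm → ∀ d' : G.Dart, d'.fst = d.snd → d' = d.symm ∨ d' = φ d)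
    (hsum : ∀ v w, G.Adj v w → 5 ≤ G.degree v + G.degree w) (v : V) :
    2 * #{d : G.Dart | d.fst = v ∧ φ (φ (φ d)) = d} ≤ G.degree v := by
  rw [← G.dart_fst_fiber_card_eq_degree v, two_mul]
  set S : Finset G.Dart := {d : G.Dart | d.fst = v ∧ φ (φ (φ d)) = d} with hS
  have hinj : Function.Injective fun d : G.Dart => (φ (φ d)).symm :=
    Dart.symm_involutive.injective.comp (φ.injective.comp φ.injective)
  have hdisj : Disjoint S (S.image fun d => (φ (φ d)).symm) := by
    rw [Finset.disjoint_right]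
    intro d' hd' hd'S
    obtain ⟨d, hd, rfl⟩ := Finset.mem_image.1 hd'
    simp only [hS, mem_filter, mem_univ, true_and] at hd hd'S
    obtain ⟨-, hd⟩ := hd
    obtain ⟨-, hd'⟩ := hd'S
    set d' := (φ (φ d)).symm with hd'def
    have e1 : d'.fst = d.fst := by
      change (φ (φ d)).snd = d.fst
      rw [← hfst, hd]
    have e2 : d'.snd = (φ d).snd := by
      change (φ (φ d)).fst = _
      exact hfst _
    have a1 := d.adj
    have a2 := (φ d).adj
    have a3 := d'.adj
    have a4 := (φ d').adj
    have a5 := (φ (φ d')).adj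
    have f1 := hfst d
    have f2 := hfst d'
    have f3 := hfst (φ d')
    have f4 := hfst (φ (φ d'))
    rw [hd'] at f4
    have hac : d.snd = (φ d').snd := by
      by_contra hne
      refine hkite ⟨d'.fst, d'.snd, d.snd, (φ d').snd, hne, a3, ?_, ?_, ?_, ?_⟩
      · rw [e1]; exact a1
      · rw [e2, ← f1]; exact a2.symm
      · rw [f4, ← f3]; exact a5.symm
      · rw [← f2]; exact a4
    have g1 : φ d' = (φ d).symm := Dart.ext' (by rw [f2, e2]; rfl) (by rw [← hac, ← f1]; rfl)
    have g2 : φ (φ d') = d.symm := Dart.ext' (by rw [f3, ← hac]; rfl) (by rw [← f4, e1]; rfl)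
    have h1 := degree_le_of_faceMap hrot (d := φ d) g1
    have h2 := degree_le_of_faceMap hrot (d := d) (by rw [← g1, g2])
    have h3 := hsum _ _ a2
    rw [f1] at h3
    have h4 : #{(φ d).symm, φ (φ d)} ≤ 2 := Finset.card_le_two
    have h5 : #{d.symm, φ d} ≤ 2 := Finset.card_le_two
    omega
  have h1 : #(S.image fun d => (φ (φ d)).symm) = #S := Finset.card_image_of_injective _ hinj
  nth_rewrite 2 [← h1]
  rw [← Finset.card_union_of_disjoint hdisj]
  refine Finset.card_le_card fun d' hd' => ?_
  rcases Finset.mem_union.1 hd' with h | h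
  · simp only [hS, mem_filter, mem_univ, true_and] at h
    simpa using h.1
  · obtain ⟨d, hd, rfl⟩ := Finset.mem_image.1 h
    simp only [hS, mem_filter, mem_univ, true_and] at hd
    obtain ⟨rfl, hd⟩ := hd
    simp only [mem_filter, mem_univ, true_and]
    change (φ (φ d)).snd = d.fst
    rw [← hfst, hd]

/-- At most one corner of a triangle has degree at most 4, so at least two of its three darts start
at a vertex of degree at least 5. -/
theorem two_mul_card_triangle_darts_le_three_mul [Fintype V] [DecidableEq V] [DecidableRel G.Adj]
    (hfst : ∀ d, (φ d).fst = d.snd) (hsum : ∀ v w, G.Adj v w → 9 ≤ G.degree v + G.degree w) :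
    2 * #{d : G.Dart | φ (φ (φ d)) = d} ≤
      3 * #{d : G.Dart | φ (φ (φ d)) = d ∧ 5 ≤ G.degree d.fst} := by
  set S : Finset G.Dart := {d : G.Dart | φ (φ (φ d)) = d} with hS
  have h1 : #{d : G.Dart | φ (φ (φ d)) = d ∧ 5 ≤ G.degree d.fst} =
      ∑ d ∈ S, if 5 ≤ G.degree d.fst then 1 else 0 := by
    rw [← Finset.card_filter, hS, Finset.filter_filter]
  have h2 : ∑ d ∈ S, (if 5 ≤ G.degree (φ d).fst then 1 else 0) =
      ∑ d ∈ S, if 5 ≤ G.degree d.fst then 1 else 0 :=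
    Finset.sum_equiv φ (fun d => by simp [hS]) (fun d _ => rfl)
  have h3 : ∑ d ∈ S, (if 5 ≤ G.degree (φ (φ d)).fst then 1 else 0) =
      ∑ d ∈ S, if 5 ≤ G.degree (φ d).fst then 1 else 0 :=
    Finset.sum_equiv φ (fun d => by simp [hS]) (fun d _ => rfl)
  have h4 : ∑ d ∈ S, 2 ≤ ∑ d ∈ S, ((if 5 ≤ G.degree d.fst then 1 else 0) +
      (if 5 ≤ G.degree (φ d).fst then 1 else 0) +
      (if 5 ≤ G.degree (φ (φ d)).fst then 1 else 0)) := by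
    refine Finset.sum_le_sum fun d hd => ?_
    have hd : φ (φ (φ d)) = d := by simpa [hS] using hd
    have a1 := hsum _ _ d.adj
    have a2 := hsum _ _ (φ d).adj
    have a3 := hsum _ _ (φ (φ d)).adj
    rw [← hfst d] at a1
    rw [← hfst (φ d)] at a2
    rw [← hfst (φ (φ d)), hd] at a3
    split_ifs <;> omega
  rw [Finset.sum_add_distrib, Finset.sum_add_distrib, h3, h2, ← h1, Finset.sum_const,
    smul_eq_mul] at h4
  omega

end FaceMap

/-- Euler's formula for planar graphs without kites, after every triangular face has distributed
its negative charge to its vertices of degree at least 5. -/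
theorem IsPlanar.exists_charge [Fintype V] [DecidableEq V] [DecidableRel G.Adj]
    (hG : G.IsPlanar) (hkite : ¬ G.HasKite) (hne : Nonempty G.Dart)
    (hdeg : ∀ d : G.Dart, 2 ≤ G.degree d.fst)
    (hsum : ∀ v w, G.Adj v w → 9 ≤ G.degree v + G.degree w) :
    ∃ t : V → ℕ, (∀ v, 2 * t v ≤ G.degree v) ∧ (∀ v, G.degree v < 5 → t v = 0) ∧
      ∑ v with 0 < G.degree v, (2 * (G.degree v : ℤ) - 8 - t v) < 0 := by
  classical
  obtain ⟨D⟩ := hG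
  obtain ⟨φ, hfst, hrot, hφ⟩ := D.exists_faceMap
  have h1 := card_edges_add_one_le φ hφ
  have h2 := card_quotient_faceMap_le hfst hrot hdeg
  have h3 := two_mul_card_triangle_darts_le_three_mul hfst hsum
  rw [G.dart_card_eq_twice_card_edges] at h2
  have h4 : #{d : G.Dart | φ (φ (φ d)) = d ∧ 5 ≤ G.degree d.fst} =
      ∑ v with 0 < G.degree v,
        (if 5 ≤ G.degree v then #{d : G.Dart | d.fst = v ∧ φ (φ (φ d)) = d} else 0) := by
    rw [Finset.card_eq_sum_card_fiberwise (f := fun d : G.Dart => d.fst)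
      (t := {v | 0 < G.degree v})]
    · refine Finset.sum_congr rfl fun v _ => ?_
      split_ifs with h
      · congr 1
        ext d
        simp only [mem_filter, mem_univ, true_and]
        constructor
        · rintro ⟨⟨h1, h2⟩, h3⟩; exact ⟨h3, h1⟩
        · rintro ⟨rfl, h1⟩; exact ⟨⟨h1, h⟩, rfl⟩
      · rw [Finset.card_eq_zero, Finset.filter_eq_empty_iff]
        rintro d hd rfl
        simp only [mem_filter] at hd
        exact h hd.2.2
    · intro d hd
      have := hdeg d
      simp only [coe_filter, mem_univ, true_and]
      change 0 < _
      omega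
  have h5 : ∑ v with 0 < G.degree v, G.degree v = 2 * #G.edgeFinset := by
    rw [← G.sum_degrees_eq_twice_card_edges]
    refine Finset.sum_subset (Finset.filter_subset _ _) fun v _ hv => ?_
    simpa using hv
  refine ⟨fun v => if 5 ≤ G.degree v then #{d : G.Dart | d.fst = v ∧ φ (φ (φ d)) = d} else 0,
    fun v => ?_, fun v hv => if_neg (by omega), ?_⟩
  · dsimp only
    split_ifs
    · exact two_mul_card_triangle_darts_le hkite hfst hrot
        (fun v w h => le_trans (by norm_num) (hsum v w h)) v
    · simp
  -- With `E` edges, `n` non-isolated vertices, `F` faces, `S` triangular darts and `T` of them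
  -- starting at degree at least 5, the bounds `E + 1 ≤ n + F`, `12F ≤ 6E + S` and `2S ≤ 3T` give
  -- `4E - 8n - T ≤ -8`.
  · rw [Finset.sum_sub_distrib, Finset.sum_sub_distrib, ← Finset.mul_sum, ← Nat.cast_sum,
      ← Nat.cast_sum, h5, ← h4, Finset.sum_const, nsmul_eq_mul]
    push_cast
    omega

end SimpleGraph

/-! ### List edge colorings of bipartite graphs -/

section Bipartite

variable {α β : Type*} [DecidableEq α] [DecidableEq β]

/-- Stable matchings: if the edges at each vertex of a bipartite graph are ranked, then some
matching contains at each edge outside of it a better edge. -/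
theorem exists_stable_matching (r s : α × β → ℕ) (E : Finset (α × β))
    (hs : ∀ e ∈ E, ∀ f ∈ E, e.2 = f.2 → s e = s f → e = f)
    (hr : ∀ e ∈ E, ∀ f ∈ E, e.1 = f.1 → r e = r f → e = f) :
    ∃ M ⊆ E, (∀ e ∈ M, ∀ f ∈ M, e ≠ f → e.1 ≠ f.1 ∧ e.2 ≠ f.2) ∧
      ∀ e ∈ E, e ∉ M → ∃ f ∈ M, (f.1 = e.1 ∧ r f < r e) ∨ (f.2 = e.2 ∧ s f < s e) := by
  induction E using Finset.strongInduction with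
  | H E ih =>
    -- Smaller rank is better. If `e` is best at its first end and beats `e'` at the second, then
    -- `e'` may be deleted: in a stable matching of the rest, either `e` or an edge beating `e` at
    -- the second end also beats `e'`.
    by_cases h : ∃ e ∈ E, ∃ e' ∈ E, (∀ f ∈ E, f.1 = e.1 → r e ≤ r f) ∧ e.2 = e'.2 ∧ s e < s e'
    · obtain ⟨e, he, e', he', hbest, h2, hlt⟩ := h
      have hne : e ≠ e' := by rintro rfl; exact lt_irrefl _ hlt
      have hsub := Finset.erase_subset e' E
      obtain ⟨M, hM, hmatch, hdom⟩ := ih (E.erase e') (Finset.erase_ssubset he')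
        (fun a ha b hb => hs a (hsub ha) b (hsub hb)) (fun a ha b hb => hr a (hsub ha) b (hsub hb))
      refine ⟨M, hM.trans hsub, hmatch, fun f hf hfM => ?_⟩
      by_cases hfe : f = e'
      · subst hfe
        by_cases heM : e ∈ M
        · exact ⟨e, heM, Or.inr ⟨h2, hlt⟩⟩
        · obtain ⟨g, hg, h3 | h3⟩ := hdom e (Finset.mem_erase.2 ⟨hne, he⟩) heM
          · exact absurd (hbest g (hsub (hM hg)) h3.1) (not_le.2 h3.2)
          · exact ⟨g, hg, Or.inr ⟨h3.1.trans h2, h3.2.trans hlt⟩⟩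
      · exact hdom f (Finset.mem_erase.2 ⟨hfe, hf⟩) hfM
    -- Now an edge that is best at its first end is last at its second end, so at most one such edge
    -- occurs at each second end and these edges form a matching.
    · push Not at h
      refine ⟨{e ∈ E | ∀ f ∈ E, f.1 = e.1 → r e ≤ r f}, Finset.filter_subset _ _, ?_, ?_⟩
      · intro e he f hf hne
        rw [Finset.mem_filter] at he hf
        refine ⟨fun h1 => hne (hr e he.1 f hf.1 h1 ?_), fun h2 => hne (hs e he.1 f hf.1 h2 ?_)⟩
        · exact le_antisymm (he.2 f hf.1 h1.symm) (hf.2 e he.1 h1)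
        · exact le_antisymm (h f hf.1 e he.1 hf.2 h2.symm) (h e he.1 f hf.1 he.2 h2)
      · intro e he heM
        obtain ⟨f, hf, hmin⟩ := Finset.exists_min_image {f ∈ E | f.1 = e.1} r ⟨e, by simp [he]⟩
        rw [Finset.mem_filter] at hf
        have hfM : ∀ g ∈ E, g.1 = f.1 → r f ≤ r g := fun g hg hgf =>
          hmin g (Finset.mem_filter.2 ⟨hg, hgf.trans hf.2⟩)
        refine ⟨f, Finset.mem_filter.2 ⟨hf.1, hfM⟩, Or.inl ⟨hf.2, ?_⟩⟩
        refine lt_of_le_of_ne (hfM e he hf.2.symm) fun h' => heM ?_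
        rw [← hr f hf.1 e he hf.2 h']
        exact Finset.mem_filter.2 ⟨hf.1, hfM⟩

/-- Galvin's list coloring theorem for line graphs of bipartite graphs. -/
theorem exists_list_edge_coloring_of_rank {C : Type*} [Nonempty C] (r s : α × β → ℕ)
    (E : Finset (α × β))
    (hs : ∀ e ∈ E, ∀ f ∈ E, e.2 = f.2 → s e = s f → e = f)
    (hr : ∀ e ∈ E, ∀ f ∈ E, e.1 = f.1 → r e = r f → e = f) (L : α × β → Finset C)
    (hL : ∀ e ∈ E, #{f ∈ E | f.1 = e.1 ∧ r f < r e} + #{f ∈ E | f.2 = e.2 ∧ s f < s e} < #(L e)) :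
    ∃ c : α × β → C, (∀ e ∈ E, c e ∈ L e) ∧
      ∀ e ∈ E, ∀ f ∈ E, e ≠ f → (e.1 = f.1 ∨ e.2 = f.2) → c e ≠ c f := by
  classical
  induction E using Finset.strongInduction generalizing L with
  | H E ih =>
    rcases E.eq_empty_or_nonempty with rfl | ⟨e₀, he₀⟩
    · exact ⟨fun _ => Classical.arbitrary C, by simp, by simp⟩
    obtain ⟨a, ha⟩ := Finset.card_pos.1 (Nat.zero_lt_of_lt (hL e₀ he₀))
    have hsubE := Finset.filter_subset (fun e => a ∈ L e) E
    -- `M` becomes the color class of `a`. A remaining edge whose list loses `a` also loses a better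
    -- edge, so the strict inequality between better edges and list size persists.
    obtain ⟨M, hM, hmatch, hdom⟩ := exists_stable_matching r s {e ∈ E | a ∈ L e}
      (fun e he f hf => hs e (hsubE he) f (hsubE hf)) (fun e he f hf => hr e (hsubE he) f (hsubE hf))
    have hMne : M.Nonempty := by
      by_cases h : e₀ ∈ M
      · exact ⟨_, h⟩
      · obtain ⟨f, hf, -⟩ := hdom e₀ (Finset.mem_filter.2 ⟨he₀, ha⟩) h
        exact ⟨f, hf⟩
    have hME := hM.trans hsubE
    have hsub : E \ M ⊆ E := Finset.sdiff_subset
    obtain ⟨c, hc1, hc2⟩ := ih (E \ M) (Finset.sdiff_ssubset hME hMne)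
      (fun e he f hf => hs e (hsub he) f (hsub hf)) (fun e he f hf => hr e (hsub he) f (hsub hf))
      (fun e => (L e).erase a) (fun e he => by
        have hlt := hL e (hsub he)
        have s1 : {f ∈ E \ M | f.1 = e.1 ∧ r f < r e} ⊆ {f ∈ E | f.1 = e.1 ∧ r f < r e} :=
          Finset.filter_subset_filter _ hsub
        have s2 : {f ∈ E \ M | f.2 = e.2 ∧ s f < s e} ⊆ {f ∈ E | f.2 = e.2 ∧ s f < s e} :=
          Finset.filter_subset_filter _ hsub
        have l1 := Finset.card_le_card s1
        have l2 := Finset.card_le_card s2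
        by_cases hae : a ∈ L e
        · rw [Finset.card_erase_of_mem hae]
          obtain ⟨f, hf, h | h⟩ := hdom e (Finset.mem_filter.2 ⟨hsub he, hae⟩)
            (Finset.mem_sdiff.1 he).2
          · have : #{f ∈ E \ M | f.1 = e.1 ∧ r f < r e} < #{f ∈ E | f.1 = e.1 ∧ r f < r e} :=
              Finset.card_lt_card ((Finset.ssubset_iff_of_subset s1).2
                ⟨f, Finset.mem_filter.2 ⟨hME hf, h⟩, by simp [hf]⟩)
            omega
          · have : #{f ∈ E \ M | f.2 = e.2 ∧ s f < s e} < #{f ∈ E | f.2 = e.2 ∧ s f < s e} :=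
              Finset.card_lt_card ((Finset.ssubset_iff_of_subset s2).2
                ⟨f, Finset.mem_filter.2 ⟨hME hf, h⟩, by simp [hf]⟩)
            omega
        · rw [Finset.erase_eq_of_notMem hae]
          omega)
    refine ⟨fun e => if e ∈ M then a else c e, fun e he => ?_, fun e he f hf hne hadj => ?_⟩
    · dsimp only
      split_ifs with h
      · exact (Finset.mem_filter.1 (hM h)).2
      · exact Finset.mem_of_mem_erase (hc1 e (Finset.mem_sdiff.2 ⟨he, h⟩))
    · dsimp only
      split_ifs with h1 h2 h2
      · have := hmatch e h1 f h2 hne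
        tauto
      · exact (Finset.ne_of_mem_erase (hc1 f (Finset.mem_sdiff.2 ⟨hf, h2⟩))).symm
      · exact Finset.ne_of_mem_erase (hc1 e (Finset.mem_sdiff.2 ⟨he, h1⟩))
      · exact hc2 e (Finset.mem_sdiff.2 ⟨he, h1⟩) f (Finset.mem_sdiff.2 ⟨hf, h2⟩) hne hadj

/-- A square matrix of natural numbers whose row and column sums all equal `n` is a sum of `n`
permutation matrices. -/
theorem exists_perms_of_sum_eq {ι : Type*} [Fintype ι] [DecidableEq ι] (n : ℕ) (N : ι → ι → ℕ)
    (hrow : ∀ i, ∑ j, N i j = n) (hcol : ∀ j, ∑ i, N i j = n) :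
    ∃ σ : Fin n → Equiv.Perm ι, ∀ i j, N i j = #{k | σ k i = j} := by
  induction n generalizing N with
  | zero =>
    refine ⟨fun k => k.elim0, fun i j => ?_⟩
    have := Finset.sum_eq_zero_iff.1 (hrow i) j (mem_univ _)
    simp [this]
  | succ n ih =>
    -- Hall's condition: the rows in `A` have total mass `(n + 1) * #A`, all of it in the columns
    -- counted on the right, each of mass `n + 1`.
    have hall : ∀ A : Finset ι, #A ≤ #(A.biUnion fun i => ({j | N i j ≠ 0} : Finset ι)) := by
      intro A
      have h1 : #A * (n + 1) ≤ #(A.biUnion fun i => ({j | N i j ≠ 0} : Finset ι)) * (n + 1) := by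
        calc #A * (n + 1) = ∑ i ∈ A, ∑ j, N i j := by simp [hrow]
          _ = ∑ i ∈ A, ∑ j ∈ A.biUnion fun i => ({j | N i j ≠ 0} : Finset ι), N i j := by
            refine Finset.sum_congr rfl fun i hi => ?_
            refine (Finset.sum_subset (Finset.subset_univ _) fun j _ hj => ?_).symm
            by_contra h
            exact hj (Finset.mem_biUnion.2 ⟨i, hi, by simpa using h⟩)
          _ = ∑ j ∈ A.biUnion fun i => ({j | N i j ≠ 0} : Finset ι), ∑ i ∈ A, N i j :=
            Finset.sum_comm
          _ ≤ ∑ j ∈ A.biUnion fun i => ({j | N i j ≠ 0} : Finset ι), ∑ i, N i j :=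
            Finset.sum_le_sum fun j _ =>
              Finset.sum_le_sum_of_subset (Finset.subset_univ _)
          _ = _ := by simp [hcol]
      exact Nat.le_of_mul_le_mul_right h1 n.succ_pos
    obtain ⟨f, hf, hf'⟩ := (Finset.all_card_le_biUnion_card_iff_exists_injective _).1 hall
    let σ₀ : Equiv.Perm ι := Equiv.ofBijective f (Finite.injective_iff_bijective.1 hf)
    have hpos (i : ι) : 1 ≤ N i (f i) := by
      have := hf' i
      rw [Finset.mem_filter] at this
      omega
    have hN (i j : ι) : N i j - (if f i = j then 1 else 0) + (if f i = j then 1 else 0) = N i j := by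
      split_ifs with h
      · subst h; have := hpos i; omega
      · rfl
    obtain ⟨σ, hσ⟩ := ih (fun i j => N i j - if f i = j then 1 else 0) (fun i => by
        have h1 := hrow i
        rw [Finset.sum_congr rfl fun j _ => (hN i j).symm, Finset.sum_add_distrib] at h1
        simpa using h1) (fun j => by
        have h1 := hcol j
        rw [Finset.sum_congr rfl fun i _ => (hN i j).symm, Finset.sum_add_distrib] at h1
        have h2 : ∑ i, (if f i = j then 1 else 0) = 1 := by
          rw [Finset.sum_boole, Nat.cast_id, Finset.card_eq_one]
          refine ⟨σ₀.symm j, Finset.ext fun i => ?_⟩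
          simp only [mem_filter, mem_univ, true_and, mem_singleton, Equiv.eq_symm_apply]
          rfl
        rw [h2] at h1
        simpa using h1)
    refine ⟨Fin.cons σ₀ σ, fun i j => ?_⟩
    rw [← hN i j, hσ, Fin.card_filter_univ_succ]
    simp only [Fin.cons_zero, Fin.cons_succ]
    change _ + (if f i = j then 1 else 0) = if f i = j then _ else _
    split_ifs <;> rfl

/-- König's edge coloring theorem for bipartite graphs. -/
theorem exists_edge_coloring_of_degree_le [Fintype α] [Fintype β] (E : Finset (α × β)) (n : ℕ)
    (hα : ∀ a, #{b | (a, b) ∈ E} ≤ n) (hβ : ∀ b, #{a | (a, b) ∈ E} ≤ n) :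
    ∃ c : α × β → ℕ, (∀ e ∈ E, c e < n) ∧
      ∀ e ∈ E, ∀ f ∈ E, e ≠ f → (e.1 = f.1 ∨ e.2 = f.2) → c e ≠ c f := by
  -- Two copies of the graph, with sides exchanged, become `n`-regular when each vertex is joined to
  -- its copy by as many parallel edges as its degree falls short of `n`.
  let N : α ⊕ β → α ⊕ β → ℕ
    | .inl a, .inr b => if (a, b) ∈ E then 1 else 0
    | .inr b, .inl a => if (a, b) ∈ E then 1 else 0
    | .inl a, .inl a' => if a = a' then n - #{b | (a, b) ∈ E} else 0
    | .inr b, .inr b' => if b = b' then n - #{a | (a, b) ∈ E} else 0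
  have hsymm (i j) : N i j = N j i := by
    rcases i with a | b <;> rcases j with a' | b' <;> simp only [N, eq_comm]
    · split_ifs with h
      · rw [h]
      · rfl
    · split_ifs with h
      · rw [h]
      · rfl
  have hrow (i) : ∑ j, N i j = n := by
    rw [Fintype.sum_sum_type]
    rcases i with a | b
    · have := hα a
      simp [N]
      omega
    · have := hβ b
      simp [N]
      omega
  obtain ⟨σ, hσ⟩ := exists_perms_of_sum_eq n N hrow (fun j => by simp only [hsymm _ j, hrow])
  have hex (e : α × β) : ∃ k : ℕ, e ∈ E → ∃ h : k < n, σ ⟨k, h⟩ (Sum.inl e.1) = Sum.inr e.2 := by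
    by_cases he : e ∈ E
    · have h1 := hσ (Sum.inl e.1) (Sum.inr e.2)
      have h2 : N (Sum.inl e.1) (Sum.inr e.2) = 1 := if_pos he
      rw [h2] at h1
      obtain ⟨k, hk⟩ := Finset.card_pos.1 (h1 ▸ one_pos)
      exact ⟨k, fun _ => ⟨k.2, by simpa using hk⟩⟩
    · exact ⟨0, fun h => absurd h he⟩
  choose c hc using hex
  refine ⟨c, fun e he => (hc e he).1, fun e he f hf hne hadj heq => hne ?_⟩
  obtain ⟨h1, h2⟩ := hc e he
  obtain ⟨h3, h4⟩ := hc f hf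
  have h5 : σ ⟨c e, h1⟩ = σ ⟨c f, h3⟩ := by congr 2
  rw [← h5] at h4
  rcases hadj with h | h
  · rw [← h, h2] at h4
    exact Prod.ext h (Sum.inr_injective h4)
  · rw [← h, ← h2] at h4
    exact (Prod.ext (Sum.inl_injective ((σ ⟨c e, h1⟩).injective h4)) h.symm).symm

/-- A bipartite graph whose edges `e` carry lists of at least `d(e.1)` colors can be colored from
the lists if all degrees on the second side are at most `i` and all degrees of the relevant vertices
on the first side are at least `i`. -/
theorem exists_list_edge_coloring [Fintype α] [Fintype β] {C : Type*} [Nonempty C]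
    (E : Finset (α × β)) {i : ℕ} (hi : 0 < i) (L : α × β → Finset C)
    (hα : ∀ e ∈ E, i ≤ #{b | (e.1, b) ∈ E}) (hβ : ∀ b, #{a | (a, b) ∈ E} ≤ i)
    (hL : ∀ e ∈ E, #{b | (e.1, b) ∈ E} ≤ #(L e)) :
    ∃ c : α × β → C, (∀ e ∈ E, c e ∈ L e) ∧
      ∀ e ∈ E, ∀ f ∈ E, e ≠ f → (e.1 = f.1 ∨ e.2 = f.2) → c e ≠ c f := by
  let S (a : α) : Finset β := {b | (a, b) ∈ E}
  have hS (e : α × β) : e.2 ∈ S e.1 ↔ e ∈ E := by simp [S]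
  let pos (e : α × β) : ℕ := if h : e.2 ∈ S e.1 then (S e.1).equivFin ⟨e.2, h⟩ else 0
  have hposlt (e) (he : e ∈ E) : pos e < #(S e.1) := by
    simp only [pos, dif_pos ((hS e).2 he)]; exact Fin.is_lt _
  have hposinj (e) (he : e ∈ E) (f) (hf : f ∈ E) (h1 : e.1 = f.1) (h : pos e = pos f) : e = f := by
    obtain ⟨a, b⟩ := e
    obtain ⟨a', b'⟩ := f
    obtain rfl : a = a' := h1
    simp only [pos, dif_pos ((hS (a, b)).2 he), dif_pos ((hS (a, b')).2 hf)] at h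
    have := (S a).equivFin.injective (Fin.ext h)
    rw [Subtype.mk.injEq] at this
    rw [this]
  have hScard (a : α) : #(S a) ≤ Fintype.card β := Finset.card_le_univ _
  -- The edges at a first-side vertex are cut into groups of `i`, only the last of which may be
  -- incomplete. `Fin.ofNat` does not wrap around here, as `pos e / i` is at most the size of `β`.
  let grp (e : α × β) : Fin (Fintype.card β + 1) := Fin.ofNat _ (pos e / i)
  have hgrp (e) (he : e ∈ E) : (grp e : ℕ) = pos e / i := by
    have h1 := hposlt e he
    have h2 := hScard e.1
    have h3 := Nat.div_le_self (pos e) i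
    exact Nat.mod_eq_of_lt (by omega)
  have hcount (a : α) (T : Finset (α × β)) (hT : ∀ e ∈ T, e ∈ E ∧ e.1 = a) (U : Finset ℕ)
      (hU : ∀ e ∈ T, pos e ∈ U) : #T ≤ #U :=
    Finset.card_le_card_of_injOn pos (fun e he => hU e he) fun e he f hf h =>
      hposinj e (hT e he).1 f (hT f hf).1 ((hT e he).2.trans (hT f hf).2.symm) h
  let split (e : α × β) : (α × Fin (Fintype.card β + 1)) × β := ((e.1, grp e), e.2)
  have hsplit (e f) (h : split e = split f) : e = f :=
    Prod.ext (Prod.mk.inj (Prod.mk.inj h).1).1 (Prod.mk.inj h).2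
  -- Splitting each first-side vertex into its groups makes all degrees at most `i`.
  obtain ⟨col, hcol1, hcol2⟩ := exists_edge_coloring_of_degree_le (E.image split) i
    (fun ⟨a, j⟩ => by
      have h1 : #{b | ((a, j), b) ∈ E.image split} ≤ #{e ∈ E | e.1 = a ∧ grp e = j} := by
        refine (Finset.card_le_card fun b hb => ?_).trans (Finset.card_image_le (f := Prod.snd))
        simp only [mem_filter, mem_univ, true_and, mem_image] at hb ⊢
        obtain ⟨e, he, hes⟩ := hb
        exact ⟨e, ⟨he, congrArg (fun x => x.1.1) hes, congrArg (fun x => x.1.2) hes⟩,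
          congrArg Prod.snd hes⟩
      have h2 := hcount a {e ∈ E | e.1 = a ∧ grp e = j} (fun e he => by
        rw [mem_filter] at he; exact ⟨he.1, he.2.1⟩) (Finset.Ico (j * i) (j * i + i)) (fun e he => by
        rw [mem_filter] at he
        have := hgrp e he.1
        rw [he.2.2] at this
        rw [this, Finset.mem_Ico]
        have h3 := Nat.div_add_mod' (pos e) i
        have h4 := Nat.mod_lt (pos e) hi
        omega)
      rw [Nat.card_Ico] at h2
      omega)
    (fun b => by
      refine le_trans ?_ (hβ b)
      refine Finset.card_le_card_of_injOn (fun x => x.1) (fun x hx => ?_) fun x hx y hy h => ?_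
      · simp only [coe_filter, mem_univ, true_and, mem_image] at hx ⊢
        obtain ⟨e, he, hes⟩ := hx
        have h1 : e.1 = x.1 := congrArg (fun x => x.1.1) hes
        have h2 : e.2 = b := congrArg Prod.snd hes
        change (x.1, b) ∈ E
        rwa [← h1, ← h2]
      · simp only [coe_filter, mem_univ, true_and, mem_image] at hx hy
        obtain ⟨e, he, hes⟩ := hx
        obtain ⟨f, hf, hfs⟩ := hy
        have h1 : e.1 = x.1 := congrArg (fun x => x.1.1) hes
        have h2 : e.2 = b := congrArg Prod.snd hes
        have h3 : f.1 = y.1 := congrArg (fun x => x.1.1) hfs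
        have h4 : f.2 = b := congrArg Prod.snd hfs
        have h5 : e = f := Prod.ext (by rw [h1, h3]; exact h) (by rw [h2, h4])
        subst h5
        exact congrArg Prod.fst (hes.symm.trans hfs))
  let κ (e : α × β) : ℕ := col (split e)
  have hκ (e) (he : e ∈ E) : κ e < i := hcol1 _ (Finset.mem_image_of_mem _ he)
  have hκ1 (e) (he : e ∈ E) (f) (hf : f ∈ E) (h1 : e.1 = f.1) (h2 : grp e = grp f)
      (h : κ e = κ f) : e = f := by
    by_contra hne
    exact hcol2 _ (Finset.mem_image_of_mem _ he) _ (Finset.mem_image_of_mem _ hf)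
      (fun h => hne (hsplit _ _ h)) (Or.inl (Prod.ext h1 h2)) h
  have hκ2 (e) (he : e ∈ E) (f) (hf : f ∈ E) (h1 : e.2 = f.2) (h : κ e = κ f) : e = f := by
    by_contra hne
    exact hcol2 _ (Finset.mem_image_of_mem _ he) _ (Finset.mem_image_of_mem _ hf)
      (fun h => hne (hsplit _ _ h)) (Or.inr h1) h
  have hrank (e) (he : e ∈ E) (f) (hf : f ∈ E)
      (h : (Fintype.card β - grp f) * i + κ f ≤ (Fintype.card β - grp e) * i + κ e) :
      grp e < grp f ∨ (grp f = grp e ∧ κ f ≤ κ e) := by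
    have h1 := hκ e he
    have h2 := hκ f hf
    have h3 := (grp e).is_lt
    have h4 := (grp f).is_lt
    rcases lt_trichotomy (grp e) (grp f) with h5 | h5 | h5
    · exact Or.inl h5
    · rw [h5] at h
      exact Or.inr ⟨h5.symm, by omega⟩
    · have h6 : (Fintype.card β - grp e) + 1 ≤ Fintype.card β - grp f := by
        have : (grp f : ℕ) < grp e := h5
        omega
      have h7 := Nat.mul_le_mul_right i h6
      rw [add_mul] at h7
      omega
  -- At the first end later groups come first and within a group small `κ`; at the second end large
  -- `κ` comes first. With `D` edges at its first end, an edge of group `j` is preceded by at most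
  -- `D - (j + 1) * i` edges of later groups, `κ` of its own group and `i - κ - 1` at the second
  -- end, fewer than `D` in all. The subtraction is truncated for the last group, and there `i ≤ D`
  -- is needed.
  refine exists_list_edge_coloring_of_rank (fun e => (Fintype.card β - grp e) * i + κ e)
    (fun e => i - κ e) E (fun e he f hf h1 h => ?_) (fun e he f hf h1 h => ?_) L (fun e he => ?_)
  · have := hκ e he
    have := hκ f hf
    exact hκ2 e he f hf h1 (by omega)
  · rcases hrank e he f hf h.ge with h2 | h2
    · rcases hrank f hf e he h.le with h3 | h3
      · exact absurd h2 h3.asymm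
      · exact absurd h3.1 h2.ne
    · rcases hrank f hf e he h.le with h3 | h3
      · exact absurd h2.1 h3.ne
      · exact hκ1 e he f hf h1 h3.1 (le_antisymm h3.2 h2.2)
  · refine lt_of_lt_of_le ?_ (hL e he)
    have hd := hα e he
    change i ≤ #(S e.1) at hd
    change _ < #(S e.1)
    have hκe := hκ e he
    have b1 : #{f ∈ E | f.1 = e.1 ∧ (Fintype.card β - grp f) * i + κ f <
        (Fintype.card β - grp e) * i + κ e} ≤
        #{f ∈ E | f.1 = e.1 ∧ grp e < grp f} + #{f ∈ E | f.1 = e.1 ∧ grp f = grp e ∧ κ f < κ e} := by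
      rw [← Finset.card_union_of_disjoint]
      · refine Finset.card_le_card fun f hf => ?_
        rw [mem_filter] at hf
        rcases hrank e he f hf.1 hf.2.2.le with h | h
        · exact mem_union_left _ (mem_filter.2 ⟨hf.1, hf.2.1, h⟩)
        · refine mem_union_right _ (mem_filter.2 ⟨hf.1, hf.2.1, h.1, ?_⟩)
          have := hf.2.2
          rw [h.1] at this
          omega
      · rw [Finset.disjoint_filter]
        rintro f - ⟨-, h1⟩ ⟨-, h2, -⟩
        exact h1.ne h2.symm
    have b2 : #{f ∈ E | f.1 = e.1 ∧ grp e < grp f} ≤ #(S e.1) - (grp e + 1) * i := by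
      have := hcount e.1 {f ∈ E | f.1 = e.1 ∧ grp e < grp f} (fun f hf => by
        rw [mem_filter] at hf; exact ⟨hf.1, hf.2.1⟩)
        (Finset.Ico ((grp e + 1) * i) #(S e.1)) (fun f hf => by
        rw [mem_filter] at hf
        rw [Finset.mem_Ico]
        refine ⟨?_, hf.2.1 ▸ hposlt f hf.1⟩
        have h1 : (grp e : ℕ) + 1 ≤ pos f / i := by
          rw [← hgrp f hf.1]; exact hf.2.2
        exact (Nat.le_div_iff_mul_le hi).1 h1)
      rwa [Nat.card_Ico] at this
    have b3 : #{f ∈ E | f.1 = e.1 ∧ grp f = grp e ∧ κ f < κ e} ≤ κ e := by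
      refine (Finset.card_le_card_of_injOn (t := range (κ e)) κ (fun f hf => ?_)
        fun f hf g hg h => ?_).trans_eq (Finset.card_range _)
      · simp only [coe_filter] at hf
        exact Finset.mem_coe.2 (Finset.mem_range.2 hf.2.2.2)
      · simp only [coe_filter] at hf hg
        exact hκ1 f hf.1 g hg.1 (hf.2.1.trans hg.2.1.symm) (hf.2.2.1.trans hg.2.2.1.symm) h
    have b4 : #{f ∈ E | f.2 = e.2 ∧ i - κ f < i - κ e} ≤ i - (κ e + 1) := by
      refine (Finset.card_le_card_of_injOn (t := Ico (κ e + 1) i) κ (fun f hf => ?_)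
        fun f hf g hg h => ?_).trans_eq (Nat.card_Ico _ _)
      · simp only [coe_filter] at hf
        have := hκ f hf.1
        have := hf.2.2
        exact Finset.mem_coe.2 (Finset.mem_Ico.2 ⟨by omega, by omega⟩)
      · simp only [coe_filter] at hf hg
        exact hκ2 f hf.1 g hg.1 (hf.2.1.trans hg.2.1.symm) h
    have b5 : (grp e + 1) * i = grp e * i + i := by ring
    rcases Nat.le_total #(S e.1) ((grp e + 1) * i) with h | h
    · have : #(S e.1) - (grp e + 1) * i = 0 := Nat.sub_eq_zero_of_le h
      omega
    · omega

end Bipartite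

/-! ### Minimal graphs that are not edge-choosable -/

namespace SimpleGraph

variable {V : Type*} {G H : SimpleGraph V}

theorem IsPlanar.mono (hG : G.IsPlanar) (h : H ≤ G) : H.IsPlanar := by
  obtain ⟨D⟩ := hG
  let ι : H.edgeSet → G.edgeSet := fun e => ⟨e, edgeSet_mono h e.2⟩
  exact ⟨{ point := D.point
           point_injective := D.point_injective
           arc := fun e => D.arc (ι e)
           isPolygonalArc := fun e v w hvw => D.isPolygonalArc (ι e) v w hvw
           mem_of_point_mem := fun e v hv => D.mem_of_point_mem (ι e) v hv
           eq_point_of_mem_of_mem := fun e f hef => D.eq_point_of_mem_of_mem (ι e) (ι f)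
            fun h' => hef (Subtype.ext (congrArg (fun x : G.edgeSet => (x : Sym2 V)) h')) }⟩

theorem HasKite.mono (hH : H.HasKite) (h : H ≤ G) : G.HasKite := by
  obtain ⟨v, w, x, y, hxy, h1, h2, h3, h4, h5⟩ := hH
  exact ⟨v, w, x, y, hxy, h h1, h h2, h h3, h h4, h h5⟩

/-- `c` is a proper coloring of the edges of `G` from the lists `L`. -/
structure IsListEdgeColoring {C : Type*} (G : SimpleGraph V) (L : Sym2 V → Finset C)
    (c : Sym2 V → C) : Prop where
  mem : ∀ e ∈ G.edgeSet, c e ∈ L e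
  ne : ∀ e ∈ G.edgeSet, ∀ f ∈ G.edgeSet, e ≠ f → ∀ v, v ∈ e → v ∈ f → c e ≠ c f

theorem EdgeChoosable.exists_isListEdgeColoring {k : ℕ} (h : G.EdgeChoosable k) {C : Type}
    [Nonempty C] (L : Sym2 V → Finset C) (hL : ∀ e ∈ G.edgeSet, k ≤ #(L e)) :
    ∃ c, G.IsListEdgeColoring L c := by
  classical
  obtain ⟨c, hc⟩ := h C (fun e => L e) (fun e => hL e e.2)
  refine ⟨fun e => if he : e ∈ G.edgeSet then c ⟨e, he⟩ else Classical.arbitrary C, ⟨?_, ?_⟩⟩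
  · intro e he
    simp only [dif_pos he]
    exact hc ⟨e, he⟩
  · intro e he f hf hne v hve hvf
    simp only [dif_pos he, dif_pos hf]
    exact c.valid ⟨fun h => hne (congrArg Subtype.val h), v, hve, hvf⟩

theorem edgeChoosable_of_exists {k : ℕ} (hk : 0 < k)
    (h : ∀ (C : Type) [Nonempty C] (L : Sym2 V → Finset C), (∀ e ∈ G.edgeSet, k ≤ #(L e)) →
      ∃ c, G.IsListEdgeColoring L c) : G.EdgeChoosable k := by
  classical
  intro C L hL
  rcases isEmpty_or_nonempty G.edgeSet with hE | ⟨⟨e₀⟩⟩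
  · exact ⟨⟨fun e => hE.elim e, fun {e} => hE.elim e⟩, fun e => hE.elim e⟩
  obtain ⟨a, -⟩ := Finset.card_pos.1 (hk.trans_le (hL e₀))
  have : Nonempty C := ⟨a⟩
  obtain ⟨c, hc⟩ := h C (fun e => if he : e ∈ G.edgeSet then L ⟨e, he⟩ else ∅) (fun e he => by
    simp only [dif_pos he]; exact hL _)
  refine ⟨⟨fun e => c e, fun {e f} hef => ?_⟩, fun e => ?_⟩
  · obtain ⟨hne, v, hv1, hv2⟩ := hef
    exact hc.ne e e.2 f f.2 (fun h => hne (Subtype.ext h)) v hv1 hv2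
  · have := hc.mem e e.2
    rwa [dif_pos e.2] at this

section Minimal

variable [Fintype V]

/-- The colors that a coloring `c` of the edges of `H` uses at the vertex `v`. -/
def usedColors {C : Type*} [DecidableEq C] (H : SimpleGraph V) [DecidableRel H.Adj]
    (c : Sym2 V → C) (v : V) : Finset C :=
  (H.neighborFinset v).image fun w => c s(v, w)

theorem mem_usedColors {C : Type*} [DecidableEq C] [DecidableRel H.Adj] (c : Sym2 V → C) {v : V}
    {e : Sym2 V} (he : e ∈ H.edgeSet) (hv : v ∈ e) : c e ∈ H.usedColors c v := by
  obtain ⟨w, rfl⟩ := Sym2.mem_iff_exists.1 hv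
  exact Finset.mem_image_of_mem _ ((H.mem_neighborFinset v w).2 he)

theorem card_usedColors_le {C : Type*} [DecidableEq C] [DecidableRel H.Adj] (c : Sym2 V → C)
    (v : V) : #(H.usedColors c v) ≤ H.degree v :=
  Finset.card_image_le

theorem IsListEdgeColoring.extend {C : Type*} [DecidableEq C] [DecidableRel H.Adj]
    {L : Sym2 V → Finset C}
    {c c' : Sym2 V → C} (hc : H.IsListEdgeColoring L c)
    (h1 : ∀ e ∈ G.edgeSet, e ∉ H.edgeSet → c' e ∈ L e ∧ ∀ v ∈ e, c' e ∉ H.usedColors c v)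
    (h2 : ∀ e ∈ G.edgeSet, ∀ f ∈ G.edgeSet, e ∉ H.edgeSet → f ∉ H.edgeSet → e ≠ f →
      ∀ v, v ∈ e → v ∈ f → c' e ≠ c' f) : ∃ c, G.IsListEdgeColoring L c := by
  refine ⟨fun e => if e ∈ H.edgeSet then c e else c' e, ⟨fun e he => ?_, ?_⟩⟩
  · split_ifs with h
    · exact hc.mem e h
    · exact (h1 e he h).1
  · intro e he f hf hne v hve hvf
    split_ifs with h h' h'
    · exact hc.ne e h f h' hne v hve hvf
    · exact fun heq => (h1 f hf h').2 v hvf (heq ▸ mem_usedColors c h hve)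
    · exact fun heq => (h1 e he h).2 v hve (heq ▸ mem_usedColors c h' hvf)
    · exact h2 e he f hf h h' hne v hve hvf

variable [DecidableEq V] [DecidableRel G.Adj] {k : ℕ}

/-- Otherwise color the graph without `uv`: the other edges at `u` and `v` use at most `k - 1`
colors, and one color of the list of `uv` is left. -/
theorem add_two_le_degree_add_degree (hk : 0 < k) (hnot : ¬ G.EdgeChoosable k)
    (hmin : ∀ H < G, H.EdgeChoosable k) {u v : V} (huv : G.Adj u v) :
    k + 2 ≤ G.degree u + G.degree v := by
  classical
  by_contra! hlt
  refine hnot (edgeChoosable_of_exists hk fun C _ L hL => ?_)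
  set H := G.deleteEdges {s(u, v)} with hH
  have hHG : H ≤ G := G.deleteEdges_le _
  have hHe (e) (he : e ∈ G.edgeSet) : e ∉ H.edgeSet ↔ e = s(u, v) := by
    rw [hH, edgeSet_deleteEdges]
    simp [he]
  have hne : H ≠ G := fun h => (hHe s(u, v) huv).2 rfl (h ▸ huv)
  obtain ⟨c, hc⟩ := (hmin H (lt_of_le_of_ne hHG hne)).exists_isListEdgeColoring L
    fun e he => hL e (edgeSet_mono hHG he)
  have hdeg (x y : V) (hxy : s(x, y) = s(u, v)) : H.degree x < G.degree x := by
    have hadj : G.Adj x y := by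
      rw [← mem_edgeSet, hxy]; exact huv
    refine Finset.card_lt_card ((Finset.ssubset_iff_of_subset fun z hz => ?_).2 ⟨y, ?_, ?_⟩)
    · rw [mem_neighborFinset] at hz ⊢; exact hHG hz
    · rw [mem_neighborFinset]; exact hadj
    · rw [mem_neighborFinset]
      exact (hHe s(x, y) hadj).2 hxy
  have hu := hdeg u v rfl
  have hv := hdeg v u Sym2.eq_swap
  have hcard : #(H.usedColors c u ∪ H.usedColors c v) < #(L s(u, v)) := by
    have h1 := Finset.card_union_le (H.usedColors c u) (H.usedColors c v)
    have h2 := card_usedColors_le (H := H) c u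
    have h3 := card_usedColors_le (H := H) c v
    have h4 := hL s(u, v) huv
    omega
  obtain ⟨a, ha, ha'⟩ := Finset.exists_mem_notMem_of_card_lt_card hcard
  rw [Finset.mem_union, not_or] at ha'
  refine hc.extend (c' := fun _ => a) (fun e he heH => ?_) fun e he f hf heH hfH hne => ?_
  · obtain rfl := (hHe e he).1 heH
    refine ⟨ha, fun x hx => ?_⟩
    rcases Sym2.mem_iff.1 hx with rfl | rfl
    · exact ha'.1
    · exact ha'.2
  · exact absurd (((hHe e he).1 heH).trans ((hHe f hf).1 hfH).symm) hne

/-- In a minimal graph that is not `k`-edge-choosable, no set of independent vertices of degree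
at most `i` is such that each of its neighbors has at least `i` neighbors in it. -/
theorem exists_card_neighbors_lt (hk : 0 < k) (hnot : ¬ G.EdgeChoosable k)
    (hmin : ∀ H < G, H.EdgeChoosable k) (hmax : ∀ v, G.degree v ≤ k) {i : ℕ} (hi : 0 < i)
    {U : Finset V} (hU : U.Nonempty) (hUdeg : ∀ u ∈ U, 0 < G.degree u ∧ G.degree u ≤ i)
    (hind : ∀ u ∈ U, ∀ v ∈ U, ¬ G.Adj u v) :
    ∃ w, (∃ u ∈ U, G.Adj w u) ∧ #{u ∈ U | G.Adj w u} < i := by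
  classical
  by_contra! hall
  refine hnot (edgeChoosable_of_exists hk fun C _ L hL => ?_)
  let H : SimpleGraph V :=
    { Adj := fun x y => G.Adj x y ∧ x ∉ U ∧ y ∉ U
      symm := ⟨fun x y h => ⟨h.1.symm, h.2.2, h.2.1⟩⟩
      loopless := ⟨fun x h => h.1.ne rfl⟩ }
  have hHG : H ≤ G := fun x y h => h.1
  obtain ⟨u₀, hu₀⟩ := hU
  obtain ⟨w₀, hw₀⟩ := (G.degree_pos_iff_exists_adj u₀).1 (hUdeg u₀ hu₀).1
  have hne : H ≠ G := fun h => by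
    have h1 : H.Adj u₀ w₀ := h ▸ hw₀
    exact h1.2.1 hu₀
  obtain ⟨c, hc⟩ := (hmin H (lt_of_le_of_ne hHG hne)).exists_isListEdgeColoring L
    fun e he => hL e (edgeSet_mono hHG he)
  have hHe (e) (he : e ∈ G.edgeSet) (heH : e ∉ H.edgeSet) : ∃ w u, e = s(w, u) ∧ G.Adj w u ∧
      u ∈ U ∧ w ∉ U := by
    induction e with | _ x y
    have he : G.Adj x y := he
    have heH : ¬ (G.Adj x y ∧ x ∉ U ∧ y ∉ U) := heH
    by_cases hx : x ∈ U
    · exact ⟨y, x, Sym2.eq_swap, he.symm, hx, fun hy => hind x hx y hy he⟩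
    · by_cases hy : y ∈ U
      · exact ⟨x, y, rfl, he, hy, hx⟩
      · exact absurd ⟨he, hx, hy⟩ heH
  let E : Finset (V × V) := {p | G.Adj p.1 p.2 ∧ p.2 ∈ U}
  have hE (w u : V) : (w, u) ∈ E ↔ G.Adj w u ∧ u ∈ U := by simp [E]
  have hcount (w : V) : #{u | (w, u) ∈ E} = #{u ∈ U | G.Adj w u} := by
    congr 1; ext u; simp [hE, and_comm]
  have hdeg (w : V) (hw : w ∉ U) : H.degree w + #{u ∈ U | G.Adj w u} ≤ G.degree w := by
    rw [← card_neighborFinset_eq_degree, ← card_neighborFinset_eq_degree,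
      ← Finset.card_union_of_disjoint]
    · refine Finset.card_le_card fun x hx => ?_
      rw [mem_neighborFinset]
      rcases Finset.mem_union.1 hx with h | h
      · exact hHG ((mem_neighborFinset _ _ _).1 h)
      · exact (Finset.mem_filter.1 h).2
    · rw [Finset.disjoint_left]
      intro x hx hx'
      have h1 : H.Adj w x := (mem_neighborFinset _ _ _).1 hx
      exact h1.2.2 (Finset.mem_filter.1 hx').1
  -- `H` has no edges at `U`, so only the colors at the end `w` outside `U` are forbidden. At least
  -- `k` minus the degree of `w` in `H` remain, which is no less than the number of neighbors of `w`
  -- in `U`.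
  obtain ⟨c', hc1, hc2⟩ := exists_list_edge_coloring E hi
    (fun p => L s(p.1, p.2) \ H.usedColors c p.1)
    (fun ⟨w, u⟩ he => by
      rw [hE] at he
      rw [hcount]
      exact hall w ⟨u, he.2, he.1⟩)
    (fun u => by
      by_cases hu : u ∈ U
      · refine le_trans (Finset.card_le_card fun w hw => ?_) (hUdeg u hu).2
        rw [mem_filter, hE] at hw
        exact (mem_neighborFinset _ _ _).2 hw.2.1.symm
      · rw [Finset.card_eq_zero.2]
        · exact hi.le
        · ext w; simp [hE, hu])
    (fun ⟨w, u⟩ he => by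
      rw [hE] at he
      have hw : w ∉ U := fun hw => hind w hw u he.2 he.1
      rw [hcount]
      have h1 := Finset.le_card_sdiff (H.usedColors c w) (L s(w, u))
      have h2 := card_usedColors_le (H := H) c w
      have h3 := hL s(w, u) he.1
      have h4 := hdeg w hw
      have h5 := hmax w
      dsimp only at h1 ⊢
      omega)
  -- Orients an edge towards its end in `U`, which is unique by independence; `e.out` is a default
  -- for edges without such an end.
  let o (e : Sym2 V) : V × V := if h : ∃ p : V × V, e = s(p.1, p.2) ∧ p.2 ∈ U then h.choose else e.out
  have ho (w u : V) (hwu : G.Adj w u) (hu : u ∈ U) : o s(w, u) = (w, u) := by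
    have h : ∃ p : V × V, s(w, u) = s(p.1, p.2) ∧ p.2 ∈ U := ⟨(w, u), rfl, hu⟩
    simp only [o, dif_pos h]
    obtain ⟨h1, h2⟩ := h.choose_spec
    rcases Sym2.eq_iff.1 h1 with ⟨h3, h4⟩ | ⟨h3, h4⟩
    · exact Prod.ext h3.symm h4.symm
    · rw [← h3] at h2
      exact absurd hwu (hind w h2 u hu)
  refine hc.extend (c' := fun e => c' (o e)) (fun e he heH => ?_) fun e he f hf heH hfH hne v hve hvf => ?_
  · obtain ⟨w, u, rfl, hwu, hu, hw⟩ := hHe e he heH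
    rw [ho w u hwu hu]
    have h1 := Finset.mem_sdiff.1 (hc1 (w, u) ((hE w u).2 ⟨hwu, hu⟩))
    refine ⟨h1.1, fun v hv => ?_⟩
    rcases Sym2.mem_iff.1 hv with rfl | rfl
    · exact h1.2
    · intro h
      obtain ⟨x, hx, -⟩ := Finset.mem_image.1 h
      have h2 : H.Adj v x := (mem_neighborFinset _ _ _).1 hx
      exact h2.2.1 hu
  · obtain ⟨w, u, rfl, hwu, hu, hw⟩ := hHe e he heH
    obtain ⟨w', u', rfl, hwu', hu', hw'⟩ := hHe f hf hfH
    simp only [ho w u hwu hu, ho w' u' hwu' hu']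
    refine hc2 _ ((hE w u).2 ⟨hwu, hu⟩) _ ((hE w' u').2 ⟨hwu', hu'⟩) ?_ ?_
    · intro h
      rw [Prod.mk.injEq] at h
      exact hne (by rw [h.1, h.2])
    · rcases Sym2.mem_iff.1 hve with rfl | rfl <;> rcases Sym2.mem_iff.1 hvf with rfl | rfl
      · exact Or.inl rfl
      · exact absurd hu' hw
      · exact absurd hu hw'
      · exact Or.inr rfl

/-- In a minimal graph that is not `k`-edge-choosable, each vertex of a set of independent vertices
of degree at most `i` has a master among its neighbors, so that no vertex is the master of `i`
vertices. -/
theorem exists_masters (hk : 0 < k) (hnot : ¬ G.EdgeChoosable k)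
    (hmin : ∀ H < G, H.EdgeChoosable k) (hmax : ∀ v, G.degree v ≤ k) {i : ℕ} (hi : 0 < i)
    (U : Finset V) (hUdeg : ∀ u ∈ U, 0 < G.degree u ∧ G.degree u ≤ i)
    (hind : ∀ u ∈ U, ∀ v ∈ U, ¬ G.Adj u v) :
    ∃ m : V → V, (∀ u ∈ U, G.Adj (m u) u) ∧ ∀ w, #{u ∈ U | m u = w} < i := by
  induction U using Finset.strongInduction with
  | H U ih =>
    rcases U.eq_empty_or_nonempty with rfl | hU
    · exact ⟨id, by simp, fun _ => by simpa using hi⟩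
    -- `w` becomes the master of all its neighbors in `U`. The vertices left over are not adjacent
    -- to `w`, so it acquires no more of them later.
    obtain ⟨w, ⟨u, hu, hwu⟩, hcard⟩ := exists_card_neighbors_lt hk hnot hmin hmax hi hU hUdeg hind
    have hsub := Finset.filter_subset (fun u => ¬ G.Adj w u) U
    obtain ⟨m, hm1, hm2⟩ := ih {u ∈ U | ¬ G.Adj w u}
      ((Finset.ssubset_iff_of_subset hsub).2 ⟨u, hu, by simp [hwu]⟩)
      (fun u hu => hUdeg u (hsub hu)) (fun u hu v hv => hind u (hsub hu) v (hsub hv))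
    refine ⟨fun u => if G.Adj w u then w else m u, fun u hu => ?_, fun x => ?_⟩
    · dsimp only
      split_ifs with h
      · exact h
      · exact hm1 u (Finset.mem_filter.2 ⟨hu, h⟩)
    · by_cases hx : x = w
      · subst hx
        refine lt_of_le_of_lt (Finset.card_le_card fun u hu => ?_) hcard
        rw [Finset.mem_filter] at hu ⊢
        refine ⟨hu.1, ?_⟩
        by_contra h
        have h2 : (if G.Adj x u then x else m u) = x := hu.2
        rw [if_neg h] at h2
        have h3 := hm1 u (Finset.mem_filter.2 ⟨hu.1, h⟩)
        rw [h2] at h3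
        exact h h3
      · refine lt_of_le_of_lt (Finset.card_le_card fun u hu => ?_) (hm2 x)
        rw [Finset.mem_filter] at hu
        have h2 : (if G.Adj w u then w else m u) = x := hu.2
        split_ifs at h2 with h
        · exact absurd h2.symm hx
        · exact Finset.mem_filter.2 ⟨Finset.mem_filter.2 ⟨hu.1, h⟩, h2⟩

/-! ### Discharging and conclusion -/

/-- Counting the set through its masters: what its members receive is what the masters pay. -/
theorem sum_card_masters_eq {U : Finset V} (hU : ∀ u ∈ U, 0 < G.degree u) {m : V → V}
    (hm : ∀ u ∈ U, G.Adj (m u) u) :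
    ∑ v with 0 < G.degree v, (if v ∈ U then 1 else 0 : ℤ) =
      ∑ v with 0 < G.degree v, (#{u ∈ U | m u = v} : ℤ) := by
  rw [← Nat.cast_sum, ← Finset.card_eq_sum_card_fiberwise (f := m) (s := U)
    (t := {v | 0 < G.degree v})]
  · rw [Finset.sum_boole]
    congr 2
    ext v
    simp only [mem_filter, mem_univ, true_and]
    exact ⟨fun h => h.2, fun h => ⟨hU v h, h⟩⟩
  · intro u hu
    simp only [coe_filter, mem_univ, true_and]
    exact (G.degree_pos_iff_exists_adj _).2 ⟨u, hm u hu⟩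

/-- A planar graph without kites is `k`-edge-choosable, where `k ≥ 9` bounds its degrees, if its
proper subgraphs are. -/
theorem edgeChoosable_of_minimal (hG : G.IsPlanar) (hkite : ¬ G.HasKite) (hk : 9 ≤ k)
    (hmax : ∀ v, G.degree v ≤ k) (hmin : ∀ H < G, H.EdgeChoosable k) : G.EdgeChoosable k := by
  by_contra hnot
  have hk0 : 0 < k := by omega
  have hadd (u v : V) (h : G.Adj u v) := add_two_le_degree_add_degree hk0 hnot hmin h
  have hne : Nonempty G.Dart := by
    by_contra hemp
    rw [not_nonempty_iff] at hemp
    have hE : IsEmpty G.edgeSet := ⟨fun ⟨e, he⟩ => by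
      induction e with | _ x y => exact hemp.elim ⟨(x, y), he⟩⟩
    exact hnot fun C L _ => ⟨⟨fun e => hE.elim e, fun {e} => hE.elim e⟩, fun e => hE.elim e⟩
  obtain ⟨t, ht1, ht2, ht3⟩ := hG.exists_charge hkite hne
    (fun d => by have := hadd _ _ d.adj; have := hmax d.snd; omega)
    (fun v w h => by have := hadd v w h; omega)
  have hmasters (i : ℕ) (hi : 0 < i) (hi' : i ≤ 3) := exists_masters hk0 hnot hmin hmax hi
    {v | 0 < G.degree v ∧ G.degree v ≤ i} (fun u hu => (Finset.mem_filter.1 hu).2)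
    (fun u hu v hv h => by
      have h1 := (Finset.mem_filter.1 hu).2
      have h2 := (Finset.mem_filter.1 hv).2
      have := hadd u v h
      omega)
  obtain ⟨m₂, ha₂, hc₂⟩ := hmasters 2 (by norm_num) (by norm_num)
  obtain ⟨m₃, ha₃, hc₃⟩ := hmasters 3 (by norm_num) (by norm_num)
  have hpos (i : ℕ) (m : V → V)
      (ha : ∀ u ∈ ({v | 0 < G.degree v ∧ G.degree v ≤ i} : Finset V), G.Adj (m u) u) (v : V)
      (h : 0 < #{u ∈ ({v | 0 < G.degree v ∧ G.degree v ≤ i} : Finset V) | m u = v}) :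
      k + 2 ≤ G.degree v + i := by
    obtain ⟨u, hu⟩ := Finset.card_pos.1 h
    obtain ⟨h1, rfl⟩ := Finset.mem_filter.1 hu
    have h2 := hadd _ _ (ha u h1)
    have h3 := (Finset.mem_filter.1 h1).2
    omega
  have hs₂ := sum_card_masters_eq (fun u hu => (Finset.mem_filter.1 hu).2.1) ha₂
  have hs₃ := sum_card_masters_eq (fun u hu => (Finset.mem_filter.1 hu).2.1) ha₃
  -- Degrees 2 and 3 end at `-4 + 4` and `-2 + 2`, degree 4 at 0. Degree 5 has `t v ≤ 2` and ends at
  -- 0 or more. A master for `i = 3` has degree at least `k - 1 ≥ 8` and pays at most 4; one for `i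
  -- = 2` has degree `k ≥ 9` and pays at most 2. The extreme cases are `16 - 8 - 4 - 4 = 0` and `18
  -- - 8 - 4 - 4 - 2 = 0`.
  have hfinal : 0 ≤ ∑ v with 0 < G.degree v, ((2 * (G.degree v : ℤ) - 8 - t v) +
      2 * (if v ∈ ({v | 0 < G.degree v ∧ G.degree v ≤ 2} : Finset V) then 1 else 0 : ℤ) +
      2 * (if v ∈ ({v | 0 < G.degree v ∧ G.degree v ≤ 3} : Finset V) then 1 else 0 : ℤ) -
      2 * (#{u ∈ ({v | 0 < G.degree v ∧ G.degree v ≤ 2} : Finset V) | m₂ u = v} : ℤ) -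
      2 * (#{u ∈ ({v | 0 < G.degree v ∧ G.degree v ≤ 3} : Finset V) | m₃ u = v} : ℤ)) := by
    refine Finset.sum_nonneg fun v hv => ?_
    have h0 := (Finset.mem_filter.1 hv).2
    obtain ⟨w, hw⟩ := (G.degree_pos_iff_exists_adj v).1 h0
    have h1 := hadd v w hw
    have h2 := hmax w
    have h3 := hmax v
    have h4 := hpos 2 m₂ ha₂ v
    have h5 := hpos 3 m₃ ha₃ v
    have h6 := hc₂ v
    have h7 := hc₃ v
    have h8 := ht1 v
    have h9 := ht2 v
    simp only [Finset.mem_filter, Finset.mem_univ, true_and] at *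
    split_ifs <;> omega
  rw [Finset.sum_sub_distrib, Finset.sum_sub_distrib, Finset.sum_add_distrib,
    Finset.sum_add_distrib, ← Finset.mul_sum, ← Finset.mul_sum, ← Finset.mul_sum, ← Finset.mul_sum,
    hs₂, hs₃] at hfinal
  linarith

end Minimal

theorem IsPlanar.edgeChoosable [Fintype V] [DecidableRel G.Adj] (hG : G.IsPlanar)
    (hkite : ¬ G.HasKite) {k : ℕ} (hk : 9 ≤ k) (hmax : ∀ v, G.degree v ≤ k) :
    G.EdgeChoosable k := by
  classical
  induction hn : #G.edgeFinset using Nat.strong_induction_on generalizing G with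
  | _ n ih =>
    subst hn
    refine edgeChoosable_of_minimal hG hkite hk hmax fun H hH => ?_
    refine ih _ (Finset.card_lt_card (edgeFinset_strict_mono hH)) (hG.mono hH.le)
      (fun h => hkite (h.mono hH.le)) (fun v => ?_) rfl
    exact (degree_le_of_le hH.le).trans (hmax v)

theorem maxDegree_le_edgeChromaticNumber [Fintype V] [DecidableRel G.Adj] :
    (G.maxDegree : ℕ∞) ≤ G.edgeChromaticNumber := by
  classical
  rcases isEmpty_or_nonempty V with hV | hV
  · simp
  obtain ⟨v, hv⟩ := G.exists_maximal_degree_vertex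
  let e (w : G.neighborSet v) : G.edgeSet := ⟨s(v, w), w.2⟩
  have he : Function.Injective e := fun w w' h => by
    have h1 := congrArg Subtype.val h
    exact Subtype.ext (Sym2.congr_right.1 h1)
  have hclique : G.lineGraph.IsClique (Finset.univ.image e : Finset G.edgeSet) := by
    intro a ha b hb hab
    simp only [coe_image, coe_univ, Set.image_univ, Set.mem_range] at ha hb
    obtain ⟨w, rfl⟩ := ha
    obtain ⟨w', rfl⟩ := hb
    exact ⟨hab, v, Sym2.mem_mk_left _ _, Sym2.mem_mk_left _ _⟩
  have := hclique.card_le_chromaticNumber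
  rwa [Finset.card_image_of_injective _ he, Finset.card_univ, card_neighborSet_eq_degree,
    ← hv] at this

theorem edgeChromaticNumber_le_listEdgeChromaticNumber :
    G.edgeChromaticNumber ≤ G.listEdgeChromaticNumber := by
  refine le_iInf₂ fun k hk => ?_
  obtain ⟨c, hc⟩ := hk ℕ (fun _ => Finset.range k) (fun _ => by simp)
  refine Colorable.chromaticNumber_le ⟨Coloring.mk (fun e => (⟨c e, Finset.mem_range.1 (hc e)⟩ : Fin k))
    fun {e f} h h' => c.valid h (congrArg Fin.val h')⟩

end SimpleGraph

theorem mainTheorem2 {V : Type*} [Fintype V] (G : SimpleGraph V) [DecidableRel G.Adj]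
    (hplanar : G.IsPlanar) (hkite : ¬ G.HasKite) (hdeg : 9 ≤ G.maxDegree) :
    G.listEdgeChromaticNumber = (G.maxDegree : ℕ∞) ∧
      G.listEdgeChromaticNumber = G.edgeChromaticNumber := by
  have h1 : G.listEdgeChromaticNumber ≤ (G.maxDegree : ℕ∞) :=
    iInf₂_le _ (hplanar.edgeChoosable hkite hdeg G.degree_le_maxDegree)
  have h2 := G.edgeChromaticNumber_le_listEdgeChromaticNumber
  have h3 := G.maxDegree_le_edgeChromaticNumber
  exact ⟨le_antisymm h1 (h3.trans h2), le_antisymm (h1.trans h3) h2⟩
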